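/- **Corollary 3.2 (Sun–Pan identity).** Let $B_n$ and $B_n(x)$ be the Bernoulli numbers and polynomials, given by $\sum_n B_n(x)\frac{w^n}{n!}=\frac{we^{xw}}{e^w-1}$ and $B_n=B_n(0)$. For even $k\ge 4$ let $$G_k(\tau)=-\frac{B_k}{2k}+\sum_{n\ge1}\sigma_{k-1}(n)e^{2\pi i n\tau}$$ be the Eisenstein series of weight $k$ on $\mathrm{SL}_2(\mathbb Z)$, and put $a_0=-B_k/(2k)$. The period integral $\int_0^{i\infty}G_k(\tau)(\tau-z)^{k-2}\,d\tau$ diverges and is understood in the regularized sense: for $\tau_0=it_0$ with $t_0>0$ and $z\in\mathbb C\setminus\{0\}$, $$r_{G_k}(z)=\int_{\tau_0}^{i\infty}\bigl(G_k(\tau)-a_0\bigr)(\tau-z)^{k-2}d\tau+\int_0^{\tau_0}\Bigl(G_k(\tau)-\frac{a_0}{\tau^{k}}\Bigr)(\tau-z)^{k-2}d\tau+\frac{a_0}{k-1}\Bigl((z-\tau_0)^{k-1}+\frac1z\Bigl(1-\frac z{\tau_0}\Bigr)^{k-1}\Bigr),$$ with integrals along the imaginary axis. Let $r^-_{G_k}(z)=\frac12\bigl(r_{G_k}(z)-r_{G_k}(-z)\bigr)$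 be its odd part. For $c=(c_n)_{n\ge 0}$ with $c_n\in\mathbb C$ write $P_c(z)=\sum_{n=0}^k c_nz^{n-1}$. Binomial coefficients $\binom sj=s(s-1)\cdots(s-j+1)/j!$ are taken for arbitrary complex $s$. (i) *(Coefficients.)* For every even $k\ge4$ and every $t_0>0$ the two integrals converge absolutely, and for all $z\ne0$ $$r_{G_k}(z)=-\frac{(k-2)!}{2}\Bigl(\sum_{n=0}^{k}\frac{B_n}{n!}\frac{B_{k-n}}{(k-n)!}z^{n-1}+\frac{\zeta(k-1)}{(2\pi i)^{k-1}}\bigl(z^{k-2}-1\bigr)\Bigr),\qquad r^-_{G_k}(z)=-\frac{(k-2)!}{2}\sum_{n=0}^{k}\frac{B_n}{n!}\frac{B_{k-n}}{(k-n)!}z^{n-1}.$$ In particular $r_{G_k}$ does not depend on $t_0$, and the coefficients of $r^-_{G_k}$ are given by Bernoulli numbers. (ii) *(Three-term relation.)* For every even $k\ge 4$ and all $z\ne0,1$, $$r_{G_k}(z)+z^{k-2}r_{G_k}\Bigl(\frac{z-1}{z}\Bigr)+(1-z)^{k-2}r_{G_k}\Bigl(\frac1{1-z}\Bigr)=0,$$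 and $p=r^-_{G_k}$ satisfies $$p(z)+(z-1)^{k-2}p\Bigl(\frac z{z-1}\Bigr)+(1-z)^{k-2}p\Bigl(\frac1{1-z}\Bigr)=0.\qquad(*)$$ (iii) *(The three-term relation yields the cyclic identity.)* Let $k\ge2$ be even and let $c$ satisfy $c_n=0$ for odd $n$ and $c_{k-n}=c_n$ for $0\le n\le k$. If $p=P_c$ satisfies $(*)$ for all $z\ne0,1$, then for all $r,s,t\in\mathbb C$ with $r+s+t=k$ $$r\langle s,t\rangle+s\langle t,r\rangle+t\langle r,s\rangle=0,\qquad \langle s,t\rangle=\sum_{j=0}^k(-1)^j\binom sj\binom t{k-j}\,j!\,(k-j)!\,c_j .$$ (iv) *(Sun–Pan cyclic identity.)* For all integers $n\ge0$ and all $r,s,t,x,y,z\in\mathbb C$ with $r+s+t=n$ and $x+y+z=1$, $$r[s,t;x,y]_n+s[t,r;y,z]_n+t[r,s;z,x]_n=0,\qquad [s,t;x,y]_n=\sum_{j=0}^n(-1)^j\binom sj\binom t{n-j}B_{n-j}(x)B_j(y).$$ -/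

import Mathlib

noncomputable section

namespace SunPan

open UpperHalfPlane MeasureTheory
open scoped MatrixGroups

/-- The level one Eisenstein series `G_k = -B_k/(2k) + ∑_{n ≥ 1} σ_{k-1}(n) q^n`
(for even `k ≥ 4`), as a multiple of the Eisenstein series `E_k` with constant term `1`. -/
def eisensteinG {k : ℕ} (hk : 3 ≤ k) : ModularForm 𝒮ℒ k :=
  (-(bernoulli k : ℂ) / (2 * k)) • ModularForm.E hk

/-- The value `f(it)` on the positive imaginary axis (used only for `t > 0`). -/
def onAxis (f : ℍ → ℂ) (t : ℝ) : ℂ := f (ofComplex (Complex.I * t))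

/-- The integrand of `∫ (f(τ) - a₀) (τ - z)^(k-2) dτ` along `τ = it`, where `a₀ = f(i∞)`. -/
def upperIntegrand (k : ℕ) (f : ℍ → ℂ) (z : ℂ) (t : ℝ) : ℂ :=
  (onAxis f t - valueAtInfty f) * (Complex.I * t - z) ^ (k - 2) * Complex.I

/-- The integrand of `∫ (f(τ) - a₀ τ^(-k)) (τ - z)^(k-2) dτ` along `τ = it`, where
`a₀ = f(i∞)`. -/
def lowerIntegrand (k : ℕ) (f : ℍ → ℂ) (z : ℂ) (t : ℝ) : ℂ :=
  (onAxis f t - valueAtInfty f / (Complex.I * t) ^ k) * (Complex.I * t - z) ^ (k - 2) * Complex.I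

/-- The regularized period integral `∫_0^{i∞} f(τ) (τ - z)^(k-2) dτ` of a modular form of even
weight `k` on the full modular group, cut at `τ₀ = i t₀`:
`∫_{τ₀}^{i∞} (f(τ) - a₀) (τ - z)^(k-2) dτ + ∫_0^{τ₀} (f(τ) - a₀ τ^(-k)) (τ - z)^(k-2) dτ
  + a₀/(k-1) * ((z - τ₀)^(k-1) + (1 - z/τ₀)^(k-1) / z)`.
The last summand is the regularized value of the divergent integrals of `a₀ (τ - z)^(k-2)` over
`(τ₀, i∞)` and of `a₀ τ^(-k) (τ - z)^(k-2)` over `(0, τ₀)`: for the primitives `(τ - z)^(k-1)/(k-1)`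
and `(1 - z/τ)^(k-1)/((k-1) z)` only the contribution of the endpoint `τ₀` is kept.
If `a₀ = 0` this is the plain integral. -/
def period (k : ℕ) (f : ℍ → ℂ) (t₀ : ℝ) (z : ℂ) : ℂ :=
  (∫ t in Set.Ioi t₀, upperIntegrand k f z t) + (∫ t in Set.Ioc 0 t₀, lowerIntegrand k f z t)
    + valueAtInfty f / (k - 1) * ((z - Complex.I * t₀) ^ (k - 1)
        + (1 - z / (Complex.I * t₀)) ^ (k - 1) / z)

/-- The odd part of a function. -/
def oddPart (p : ℂ → ℂ) (z : ℂ) : ℂ := (p z - p (-z)) / 2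

/-- The three-term relation
`p(z) + (z-1)^(k-2) p(z/(z-1)) + (1-z)^(k-2) p(1/(1-z)) = 0`. -/
def ThreeTerm (k : ℕ) (p : ℂ → ℂ) : Prop :=
  ∀ z : ℂ, z ≠ 0 → z ≠ 1 →
    p z + (z - 1) ^ (k - 2) * p (z / (z - 1)) + (1 - z) ^ (k - 2) * p (1 / (1 - z)) = 0

/-- The Laurent polynomial `∑_{n=0}^k c_n z^(n-1)`. -/
def laurent (k : ℕ) (c : ℕ → ℂ) (z : ℂ) : ℂ :=
  ∑ n ∈ Finset.range (k + 1), c n * z ^ ((n : ℤ) - 1)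

/-- `∑_{j=0}^n (-1)^j (s choose j) (t choose n-j) a_j`, with generalized binomial coefficients. -/
def weightedBracket (s t : ℂ) (n : ℕ) (a : ℕ → ℂ) : ℂ :=
  ∑ j ∈ Finset.range (n + 1), (-1) ^ j * Ring.choose s j * Ring.choose t (n - j) * a j

/-- The Bernoulli polynomial `B_n(x)` at a complex argument. -/
def bernoulliPoly (n : ℕ) (x : ℂ) : ℂ := Polynomial.aeval x (Polynomial.bernoulli n)

/-- The bracket `[s, t; x, y]_n = ∑_{j=0}^n (-1)^j (s choose j) (t choose n-j) B_{n-j}(x) B_j(y)`. -/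
def bracket (s t x y : ℂ) (n : ℕ) : ℂ :=
  weightedBracket s t n fun j => bernoulliPoly (n - j) x * bernoulliPoly j y

end SunPan

end

noncomputable section

namespace SunPan

open UpperHalfPlane MeasureTheory
open scoped MatrixGroups

/-! Both cyclic identities come from relations `z Φ₁(x,y) + x Φ₂(y,z) + y Φ₃(z,x) = 0` between
homogeneous polynomials on the plane `x + y + z = 0`. Setting `y = 1`, the functional `X^i ↦ (s)_i
(t)_(n+1-i)` treats `X`, `1` and `-1-X` symmetrically when `r + s + t = n`, so applying it replaces
powers by falling factorials (`cyclic_falling_of_homog`). For an even palindromic Laurent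
polynomial, the three-term relation is the case of equal `Φᵢ` (`threeTerm_laurent_iff`). For
Bernoulli polynomials, the relation is the `w^n`-coefficient of an identity between products of two
series `a w e^(axw)/(e^(aw) - 1)`, whose numerators telescope over a common denominator
(`bernoulliSeries_cyclic`).

The period does not depend on the cut `t₀`. At `t₀ = 1` its integrals are Mellin moments of the
regularized function, so it is a combination of the values `Λ(m+1)`, `0 ≤ m ≤ k-2`, plus two terms
from the constant term `a₀` (`period_eq_sum_Lambda`). Since `Λ(s) = (2π)^(-s) Γ(s) ζ(s) ζ(s-k+1)`,
these values are Bernoulli products, zeros, or multiples of `ζ(k-1)`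
(`choose_mul_Lambda_eisensteinG`). The three-term relation is then read off from the coefficients:
the Bernoulli part is the generating-function relation at `(x,y,z) = (0,0,1)`, and the multiple of
`z^(k-2) - 1` telescopes. -/

/-! ### From powers to falling factorials -/

/-- The homogeneous polynomial `∑_{j=0}^n A_j x^j y^(n-j)` evaluated at `(x, y)`. -/
def homog (n : ℕ) (A : ℕ → ℂ) (x y : ℂ) : ℂ :=
  ∑ j ∈ Finset.range (n + 1), A j * x ^ j * y ^ (n - j)

/-- The falling factorial `s (s-1) ⋯ (s-j+1)`. -/
def falling (j : ℕ) (s : ℂ) : ℂ := (descPochhammer ℂ j).eval s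

lemma falling_zero (s : ℂ) : falling 0 s = 1 := by simp [falling]

lemma falling_one (s : ℂ) : falling 1 s = s := by simp [falling]

lemma falling_succ (j : ℕ) (s : ℂ) : falling (j + 1) s = falling j s * (s - j) := by
  simp [falling, descPochhammer_succ_eval]

lemma falling_eq_factorial_mul_choose (j : ℕ) (s : ℂ) :
    falling j s = j.factorial * Ring.choose s j := by
  have := Ring.descPochhammer_eq_factorial_smul_choose s j
  rw [nsmul_eq_mul] at this
  rw [← this, falling, ← descPochhammer_map (Int.castRingHom ℂ) j, Polynomial.eval_map,
    Polynomial.eval₂_eq_sum, Polynomial.smeval_eq_sum]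
  refine Finset.sum_congr rfl fun i _ => ?_
  simp [Polynomial.smul_pow]

open Polynomial in
/-- The linear functional on polynomials with `X^i ↦ (s)_i (t)_(N-i)`, where `(s)_i` is the
falling factorial. -/
def fallingFunctional (N : ℕ) (s t : ℂ) : ℂ[X] →ₗ[ℂ] ℂ :=
  (Polynomial.basisMonomials ℂ).constr ℂ fun i => falling i s * falling (N - i) t

open Polynomial in
lemma fallingFunctional_X_pow (N : ℕ) (s t : ℂ) (i : ℕ) :
    fallingFunctional N s t (X ^ i) = falling i s * falling (N - i) t := by
  have := (Polynomial.basisMonomials ℂ).constr_basis ℂ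
    (fun i => falling i s * falling (N - i) t) i
  rw [Polynomial.coe_basisMonomials] at this
  rw [← this, fallingFunctional, ← Polynomial.monomial_one_right_eq_X_pow]

open Polynomial in
/-- The functional is symmetric in the three variables `X`, `1` and `-1-X`, which sum to zero. -/
lemma fallingFunctional_apply_mul_pow {n : ℕ} {r s t : ℂ} (h : r + s + t = n) (l : ℕ) :
    ∀ i j : ℕ, i + j + l = n + 1 →
      fallingFunctional (n + 1) s t (X ^ i * (-1 - X) ^ l)
        = falling i s * falling j t * falling l r := by
  induction l with
  | zero =>
    intro i j hij
    rw [pow_zero, mul_one, fallingFunctional_X_pow, falling_zero, mul_one]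
    congr 2
    omega
  | succ l ih =>
    intro i j hij
    have e : (X ^ i * (-1 - X) ^ (l + 1) : ℂ[X])
        = -(X ^ i * (-1 - X) ^ l) - X ^ (i + 1) * (-1 - X) ^ l := by ring
    rw [e, map_sub, map_neg, ih i (j + 1) (by omega), ih (i + 1) j (by omega), falling_succ,
      falling_succ, falling_succ]
    -- Splitting off one factor `-1 - X` produces `-(t - j) - (s - i)`, which equals `r - l` because
    -- `i + j + l = n = r + s + t`.
    have hc : (i : ℂ) + j + l = n := by
      have : i + j + l = n := by omega
      exact_mod_cast this
    linear_combination (falling i s * falling j t * falling l r) * (hc - h)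

open Polynomial in
/-- If three homogeneous polynomials satisfy `z Φ₁(x,y) + x Φ₂(y,z) + y Φ₃(z,x) = 0` on
`x + y + z = 0`, then replacing powers by falling factorials at `r + s + t = n` gives a valid
cyclic relation. -/
theorem cyclic_falling_of_homog {n : ℕ} {A B C : ℕ → ℂ}
    (h : ∀ x : ℂ, x ≠ 0 → x ≠ -1 →
      (-1 - x) * homog n A x 1 + x * homog n B 1 (-1 - x) + homog n C (-1 - x) x = 0)
    {r s t : ℂ} (hrst : r + s + t = n) :
    r * ∑ j ∈ Finset.range (n + 1), A j * falling j s * falling (n - j) t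
      + s * ∑ j ∈ Finset.range (n + 1), B j * falling j t * falling (n - j) r
      + t * ∑ j ∈ Finset.range (n + 1), C j * falling j r * falling (n - j) s = 0 := by
  -- The relation holds off two points, hence as an identity of polynomials, to which the functional
  -- can be applied.
  have key : ∑ j ∈ Finset.range (n + 1), A j • (X ^ j * (-1 - X) ^ 1 : ℂ[X])
      + ∑ j ∈ Finset.range (n + 1), B j • (X ^ 1 * (-1 - X) ^ (n - j) : ℂ[X])
      + ∑ j ∈ Finset.range (n + 1), C j • (X ^ (n - j) * (-1 - X) ^ j : ℂ[X]) = 0 := by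
    refine Polynomial.eq_zero_of_infinite_isRoot _ ?_
    refine Set.Infinite.mono (s := ({0, -1} : Set ℂ)ᶜ) ?_ (Set.toFinite _).infinite_compl
    intro x hx
    simp only [Set.mem_compl_iff, Set.mem_insert_iff, Set.mem_singleton_iff, not_or] at hx
    rw [Set.mem_ofPred_eq, Polynomial.IsRoot.def, ← h x hx.1 hx.2]
    simp only [homog, eval_add, eval_finsetSum, eval_smul, eval_mul, eval_pow, eval_sub, eval_neg,
      eval_one, eval_X, smul_eq_mul, Finset.mul_sum, one_pow]
    congr 1
    · congr 1 <;> exact Finset.sum_congr rfl fun j _ => by ring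
    · exact Finset.sum_congr rfl fun j _ => by ring
  have := congrArg (fallingFunctional (n + 1) s t) key
  simp only [map_add, map_sum, map_smul, map_zero, smul_eq_mul] at this
  rw [← this, Finset.mul_sum, Finset.mul_sum, Finset.mul_sum]
  congr 1
  · congr 1
    · refine Finset.sum_congr rfl fun j hj => ?_
      have hj := Finset.mem_range.1 hj
      rw [fallingFunctional_apply_mul_pow hrst 1 j (n - j) (by omega), falling_one]
      ring
    · refine Finset.sum_congr rfl fun j hj => ?_
      have hj := Finset.mem_range.1 hj
      rw [fallingFunctional_apply_mul_pow hrst (n - j) 1 j (by omega), falling_one]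
      ring
  · refine Finset.sum_congr rfl fun j hj => ?_
    have hj := Finset.mem_range.1 hj
    rw [fallingFunctional_apply_mul_pow hrst j (n - j) 1 (by omega), falling_one]
    ring

lemma weightedBracket_eq_sum_falling (s t : ℂ) (n : ℕ) (a : ℕ → ℂ) :
    weightedBracket s t n a = ∑ j ∈ Finset.range (n + 1),
      (-1) ^ j * (a j / (j.factorial * (n - j).factorial)) * falling j s * falling (n - j) t := by
  refine Finset.sum_congr rfl fun j _ => ?_
  rw [falling_eq_factorial_mul_choose, falling_eq_factorial_mul_choose]
  have := Nat.cast_ne_zero (R := ℂ).2 j.factorial_ne_zero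
  have := Nat.cast_ne_zero (R := ℂ).2 (n - j).factorial_ne_zero
  field_simp

/-! ### Three-term relations in homogeneous form -/

lemma laurent_eq_homog (k : ℕ) (c : ℕ → ℂ) {x y : ℂ} (hx : x ≠ 0) (hy : y ≠ 0) :
    laurent k c (x / y) = homog k c x y / (x * y ^ ((k : ℤ) - 1)) := by
  rw [laurent, homog, Finset.sum_div]
  refine Finset.sum_congr rfl fun j hj => ?_
  have hj : j ≤ k := Nat.lt_succ_iff.1 (Finset.mem_range.1 hj)
  have e : y ^ (k - j) = y ^ ((k : ℤ) - 1) / y ^ ((j : ℤ) - 1) := by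
    rw [← zpow_sub₀ hy, ← zpow_natCast]
    congr 1
    omega
  rw [e, div_zpow, zpow_sub_one₀ hx j, zpow_natCast]
  have := zpow_ne_zero ((k : ℤ) - 1) hy
  field_simp

lemma homog_comm {k : ℕ} {c : ℕ → ℂ} (hc : ∀ n, n ≤ k → c (k - n) = c n) (x y : ℂ) :
    homog k c x y = homog k c y x := by
  rw [homog, ← Finset.sum_range_reflect]
  refine Finset.sum_congr rfl fun j hj => ?_
  have hj : j ≤ k := Nat.lt_succ_iff.1 (Finset.mem_range.1 hj)
  rw [show k + 1 - 1 - j = k - j by omega, hc j hj, show k - (k - j) = j by omega]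
  ring

lemma homog_neg_left {k : ℕ} {c : ℕ → ℂ} (hodd : ∀ n, n ≤ k → Odd n → c n = 0) (x y : ℂ) :
    homog k c (-x) y = homog k c x y := by
  refine Finset.sum_congr rfl fun j hj => ?_
  have hj : j ≤ k := Nat.lt_succ_iff.1 (Finset.mem_range.1 hj)
  rcases j.even_or_odd with h | h
  · rw [h.neg_pow]
  · simp [hodd j hj h]

/-- The three-term relation of a Laurent polynomial in homogeneous form. -/
lemma threeTerm_laurent_iff {k : ℕ} (hk : 2 ≤ k) (hk2 : Even k) {c : ℕ → ℂ}
    (hodd : ∀ n, n ≤ k → Odd n → c n = 0) (hc : ∀ n, n ≤ k → c (k - n) = c n) :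
    ThreeTerm k (laurent k c) ↔ ∀ x : ℂ, x ≠ 0 → x ≠ -1 →
      (-1 - x) * homog k c x 1 + x * homog k c 1 (-1 - x) + homog k c (-1 - x) x = 0 := by
  have hk1 : ((k : ℤ) - 1) = ((k - 2 : ℕ) : ℤ) + 1 := by omega
  -- The arguments `z`, `z/(z-1)`, `1/(1-z)` are, up to sign and inversion, the ratios of the triple
  -- `(-z, 1, z-1)`, which sums to zero. Parity and palindromy of `c` absorb the signs and
  -- inversions; `z (z-1)` clears the denominators.
  have key : ∀ z : ℂ, z ≠ 0 → z ≠ 1 →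
      z * (z - 1) * (laurent k c z + (z - 1) ^ (k - 2) * laurent k c (z / (z - 1))
        + (1 - z) ^ (k - 2) * laurent k c (1 / (1 - z)))
      = (-1 - -z) * homog k c (-z) 1 + -z * homog k c 1 (-1 - -z) + homog k c (-1 - -z) (-z) := by
    intro z hz hz1
    have h1 : z - 1 ≠ 0 := sub_ne_zero.2 hz1
    have h2 : 1 - z ≠ 0 := sub_ne_zero.2 hz1.symm
    have e1 := laurent_eq_homog k c hz one_ne_zero
    rw [div_one, one_zpow, mul_one] at e1
    rw [e1, laurent_eq_homog k c hz h1, laurent_eq_homog k c one_ne_zero h2, hk1,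
      zpow_add_one₀ h1, zpow_add_one₀ h2, zpow_natCast, zpow_natCast,
      homog_neg_left hodd, homog_comm hc _ (-z), homog_neg_left hodd,
      homog_comm hc 1 (1 - z), homog_comm hc 1 (-1 - -z),
      show 1 - z = -(z - 1) by ring, show -1 - -z = z - 1 by ring, homog_neg_left hodd]
    have := pow_ne_zero (k - 2) h1
    have hev : Even (k - 2) := by
      obtain ⟨m, rfl⟩ := hk2
      exact ⟨m - 1, by omega⟩
    rw [hev.neg_pow]
    field_simp
    ring
  constructor
  · intro h x hx hx1
    have := key (-x) (neg_ne_zero.2 hx) (fun h' => hx1 (by rw [← h', neg_neg]))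
    rw [h (-x) (neg_ne_zero.2 hx) (fun h' => hx1 (by rw [← h', neg_neg])), mul_zero, neg_neg] at this
    exact this.symm
  · intro h z hz hz1
    have := key z hz hz1
    rw [h (-z) (neg_ne_zero.2 hz) (fun h' => hz1 (neg_inj.1 h'))] at this
    exact (mul_eq_zero.1 this).resolve_left (mul_ne_zero hz (sub_ne_zero.2 hz1))

/-- The three-term relation implies the cyclic identity for the coefficients. -/
theorem cyclic_of_threeTerm {k : ℕ} (hk : 2 ≤ k) (hk2 : Even k) {c : ℕ → ℂ}
    (hodd : ∀ n, Odd n → c n = 0) (hc : ∀ n, n ≤ k → c (k - n) = c n)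
    (h : ThreeTerm k (laurent k c)) {r s t : ℂ} (hrst : r + s + t = k) :
    r * weightedBracket s t k (fun j => (j.factorial : ℂ) * ((k - j).factorial : ℂ) * c j)
      + s * weightedBracket t r k (fun j => (j.factorial : ℂ) * ((k - j).factorial : ℂ) * c j)
      + t * weightedBracket r s k (fun j => (j.factorial : ℂ) * ((k - j).factorial : ℂ) * c j)
      = 0 := by
  have hw : ∀ s t : ℂ,
      weightedBracket s t k (fun j => (j.factorial : ℂ) * ((k - j).factorial : ℂ) * c j)
        = ∑ j ∈ Finset.range (k + 1), c j * falling j s * falling (k - j) t := by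
    intro s t
    rw [weightedBracket_eq_sum_falling]
    refine Finset.sum_congr rfl fun j _ => ?_
    rw [mul_div_cancel_left₀ _ (mul_ne_zero (Nat.cast_ne_zero.2 j.factorial_ne_zero)
      (Nat.cast_ne_zero.2 (k - j).factorial_ne_zero))]
    -- The sign `(-1)^j` of the bracket is invisible because `c` lives on even indices.
    rcases j.even_or_odd with h | h
    · rw [h.neg_one_pow, one_mul]
    · rw [hodd j h, mul_zero]
  rw [hw, hw, hw]
  exact cyclic_falling_of_homog
    ((threeTerm_laurent_iff hk hk2 (fun n _ => hodd n) hc).1 h) hrst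

/-! ### Generating functions of Bernoulli polynomials -/

/-- The exponential generating function of the Bernoulli polynomials at `x`, rescaled by `a`. -/
def bernoulliSeries (x a : ℂ) : PowerSeries ℂ :=
  PowerSeries.rescale a (PowerSeries.mk fun n => bernoulliPoly n x / n.factorial)

lemma bernoulliSeries_mul (x a : ℂ) :
    bernoulliSeries x a * (PowerSeries.rescale a (PowerSeries.exp ℂ) - 1)
      = PowerSeries.C a * PowerSeries.X * PowerSeries.rescale (a * x) (PowerSeries.exp ℂ) := by
  have h := congrArg (PowerSeries.rescale a) (Polynomial.bernoulli_generating_function (A := ℂ) x)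
  rw [map_mul, map_mul, map_sub, map_one, PowerSeries.rescale_X, PowerSeries.rescale_rescale,
    mul_comm x a] at h
  rw [← h, bernoulliSeries]
  congr 3
  ext n
  simp [bernoulliPoly, Algebra.smul_def, div_eq_inv_mul]

lemma coeff_bernoulliSeries_mul (x y a b : ℂ) (n : ℕ) :
    PowerSeries.coeff n (bernoulliSeries x a * bernoulliSeries y b)
      = homog n (fun j => bernoulliPoly j x / j.factorial
          * (bernoulliPoly (n - j) y / (n - j).factorial)) a b := by
  rw [PowerSeries.coeff_mul, Finset.Nat.sum_antidiagonal_eq_sum_range_succ_mk, homog]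
  refine Finset.sum_congr rfl fun j _ => ?_
  simp only [bernoulliSeries, PowerSeries.coeff_rescale, PowerSeries.coeff_mk]
  ring

lemma rescale_exp_sub_one_ne_zero {a : ℂ} (ha : a ≠ 0) :
    PowerSeries.rescale a (PowerSeries.exp ℂ) - 1 ≠ 0 := by
  intro h
  have := congrArg (PowerSeries.coeff 1) h
  simp [PowerSeries.coeff_rescale, PowerSeries.coeff_exp, PowerSeries.coeff_one, ha] at this

/-- Multiplying by the nonzero product of the three factors `e^(aw) - 1`, `e^(bw) - 1`, `e^(cw) - 1`
leaves `abc w²` times `U (e^(cw) - 1) + W (e^(aw) - 1) + V (e^(bw) - 1)`. The two linear constraints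
give `U e^(cw) = V`, `W e^(aw) = U` and `V e^(bw) = W`, so this sum telescopes to zero. -/
theorem bernoulliSeries_cyclic {a b c x y z : ℂ} (ha : a ≠ 0) (hb : b ≠ 0) (hc : c ≠ 0)
    (habc : a + b + c = 0) (hxyz : x + y + z = 1) :
    PowerSeries.C c * (bernoulliSeries (1 - y) a * bernoulliSeries x b)
      + PowerSeries.C a * (bernoulliSeries (1 - z) b * bernoulliSeries y c)
      + PowerSeries.C b * (bernoulliSeries (1 - x) c * bernoulliSeries z a) = 0 := by
  have hD := mul_ne_zero (mul_ne_zero (rescale_exp_sub_one_ne_zero ha)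
    (rescale_exp_sub_one_ne_zero hb)) (rescale_exp_sub_one_ne_zero hc)
  refine (mul_eq_zero.1 ?_).resolve_right hD
  have a1 := bernoulliSeries_mul (1 - y) a
  have b1 := bernoulliSeries_mul x b
  have b2 := bernoulliSeries_mul (1 - z) b
  have c2 := bernoulliSeries_mul y c
  have c3 := bernoulliSeries_mul (1 - x) c
  have a3 := bernoulliSeries_mul z a
  have hE : ∀ u v w : ℂ, u + v = w → PowerSeries.rescale u (PowerSeries.exp ℂ)
      * PowerSeries.rescale v (PowerSeries.exp ℂ) = PowerSeries.rescale w (PowerSeries.exp ℂ) := by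
    rintro u v w rfl
    exact PowerSeries.exp_mul_exp_eq_exp_add u v
  set U := PowerSeries.rescale (a * (1 - y) + b * x) (PowerSeries.exp ℂ)
  set W := PowerSeries.rescale (b * (1 - z) + c * y) (PowerSeries.exp ℂ)
  set V := PowerSeries.rescale (c * (1 - x) + a * z) (PowerSeries.exp ℂ)
  have e1 := hE (a * (1 - y)) (b * x) _ rfl
  have e2 := hE (b * (1 - z)) (c * y) _ rfl
  have e3 := hE (c * (1 - x)) (a * z) _ rfl
  have f1 := hE (a * (1 - y) + b * x) c (c * (1 - x) + a * z)
    (by linear_combination -a * hxyz + x * habc)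
  have f2 := hE (b * (1 - z) + c * y) a (a * (1 - y) + b * x)
    (by linear_combination -b * hxyz + y * habc)
  have f3 := hE (c * (1 - x) + a * z) b (b * (1 - z) + c * y)
    (by linear_combination -c * hxyz + z * habc)
  set K := PowerSeries.C a * PowerSeries.C b * PowerSeries.C c * PowerSeries.X ^ 2
  set Ea := PowerSeries.rescale a (PowerSeries.exp ℂ)
  set Eb := PowerSeries.rescale b (PowerSeries.exp ℂ)
  set Ec := PowerSeries.rescale c (PowerSeries.exp ℂ)
  calc _ = PowerSeries.C c * (bernoulliSeries (1 - y) a * (Ea - 1)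
          * (bernoulliSeries x b * (Eb - 1))) * (Ec - 1)
        + PowerSeries.C a * (bernoulliSeries (1 - z) b * (Eb - 1)
          * (bernoulliSeries y c * (Ec - 1))) * (Ea - 1)
        + PowerSeries.C b * (bernoulliSeries (1 - x) c * (Ec - 1)
          * (bernoulliSeries z a * (Ea - 1))) * (Eb - 1) := by ring
    _ = 0 := by
      rw [a1, b1, b2, c2, c3, a3]
      linear_combination K * ((Ec - 1) * e1 + (Ea - 1) * e2 + (Eb - 1) * e3 + f1 + f2 + f3)

theorem homog_bernoulli_cyclic {a b c x y z : ℂ} (ha : a ≠ 0) (hb : b ≠ 0) (hc : c ≠ 0)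
    (habc : a + b + c = 0) (hxyz : x + y + z = 1) (n : ℕ) :
    c * homog n (fun j => bernoulliPoly j (1 - y) / j.factorial
          * (bernoulliPoly (n - j) x / (n - j).factorial)) a b
      + a * homog n (fun j => bernoulliPoly j (1 - z) / j.factorial
          * (bernoulliPoly (n - j) y / (n - j).factorial)) b c
      + b * homog n (fun j => bernoulliPoly j (1 - x) / j.factorial
          * (bernoulliPoly (n - j) z / (n - j).factorial)) c a = 0 := by
  have := congrArg (PowerSeries.coeff n) (bernoulliSeries_cyclic ha hb hc habc hxyz)
  simpa only [map_add, PowerSeries.coeff_C_mul, coeff_bernoulliSeries_mul, map_zero] using this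

lemma bernoulliPoly_one_sub (n : ℕ) (x : ℂ) :
    bernoulliPoly n (1 - x) = (-1) ^ n * bernoulliPoly n x := by
  have := congrArg (Polynomial.aeval x) (Polynomial.bernoulli_comp_one_sub_X n)
  simpa [bernoulliPoly, Polynomial.aeval_comp] using this

lemma bernoulliPoly_zero (n : ℕ) : bernoulliPoly n 0 = (bernoulli n : ℂ) := by
  have := Polynomial.aeval_algebraMap_apply ℂ (0 : ℚ) (Polynomial.bernoulli n)
  simpa [bernoulliPoly] using this

/-- The cyclic identity for Bernoulli polynomials. -/
theorem bracket_cyclic {n : ℕ} {r s t x y z : ℂ} (hrst : r + s + t = n) (hxyz : x + y + z = 1) :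
    r * bracket s t x y n + s * bracket t r y z n + t * bracket r s z x n = 0 := by
  -- The sign `(-1)^j` is absorbed by the reflection `B_j(1-y) = (-1)^j B_j(y)`.
  have hb : ∀ s t x y : ℂ, bracket s t x y n = ∑ j ∈ Finset.range (n + 1),
      bernoulliPoly j (1 - y) / j.factorial * (bernoulliPoly (n - j) x / (n - j).factorial)
        * falling j s * falling (n - j) t := by
    intro s t x y
    rw [bracket, weightedBracket_eq_sum_falling]
    refine Finset.sum_congr rfl fun j _ => ?_
    rw [bernoulliPoly_one_sub]
    ring
  rw [hb, hb, hb]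
  refine cyclic_falling_of_homog (fun u hu hu1 => ?_) hrst
  have := homog_bernoulli_cyclic (a := u) (b := 1) (c := -1 - u) hu one_ne_zero
    (fun h => hu1 (by linear_combination -h)) (by ring) hxyz n
  rwa [one_mul] at this

/-- The products `B_n B_(k-n) / (n! (k-n)!)`. -/
def bernoulliProd (k n : ℕ) : ℂ :=
  (bernoulli n : ℂ) / (n.factorial : ℂ) * ((bernoulli (k - n) : ℂ) / ((k - n).factorial : ℂ))

lemma bernoulliProd_symm {k n : ℕ} (h : n ≤ k) : bernoulliProd k (k - n) = bernoulliProd k n := by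
  rw [bernoulliProd, bernoulliProd, Nat.sub_sub_self h, mul_comm]

/-- Both `n` and `k - n` are odd, and they cannot both be `1` since `k ≥ 3`, so one factor is a
vanishing odd Bernoulli number. -/
lemma bernoulliProd_odd {k : ℕ} (hk : 3 ≤ k) (hk2 : Even k) {n : ℕ} (hn : n ≤ k) (h : Odd n) :
    bernoulliProd k n = 0 := by
  obtain ⟨m, rfl⟩ := hk2
  obtain ⟨l, rfl⟩ := h
  rcases Nat.eq_zero_or_pos l with rfl | hl
  · rw [bernoulliProd, bernoulli_eq_zero_of_odd (n := m + m - _) ⟨m - 1, by omega⟩ (by omega)]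
    simp
  · rw [bernoulliProd, bernoulli_eq_zero_of_odd ⟨l, rfl⟩ (by omega)]
    simp

/-- At `(x,y,z) = (0,0,1)` the three coefficient sequences differ from `bernoulliProd k` only by
signs `(-1)^j` or `(-1)^k`. The former matter only at odd `j`, where the product vanishes; the
latter is `1`. -/
theorem threeTerm_laurent_bernoulliProd {k : ℕ} (hk : 3 ≤ k) (hk2 : Even k) :
    ThreeTerm k (laurent k (bernoulliProd k)) := by
  rw [threeTerm_laurent_iff (by omega) hk2 (fun n hn h => bernoulliProd_odd hk hk2 hn h)
    fun n hn => bernoulliProd_symm hn]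
  intro u hu hu1
  have := homog_bernoulli_cyclic (a := u) (b := 1) (c := -1 - u) (x := 0) (y := 0) (z := 1) hu
    one_ne_zero (fun h => hu1 (by linear_combination -h)) (by ring) (by ring) k
  have e1 : ∀ j, j ≤ k → bernoulliPoly j (1 - 0) / j.factorial
      * (bernoulliPoly (k - j) 0 / (k - j).factorial) = bernoulliProd k j := by
    intro j hj
    rcases j.even_or_odd with h | h
    · rw [bernoulliPoly_one_sub, h.neg_one_pow, one_mul, bernoulliPoly_zero, bernoulliPoly_zero,
        bernoulliProd]
    · have h0 := bernoulliProd_odd hk hk2 hj h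
      rw [bernoulliPoly_one_sub, h.neg_one_pow, bernoulliPoly_zero, bernoulliPoly_zero, h0]
      rw [bernoulliProd] at h0
      linear_combination -h0
  have e2 : ∀ j, j ≤ k → bernoulliPoly j (1 - 0) / j.factorial
      * (bernoulliPoly (k - j) 1 / (k - j).factorial) = bernoulliProd k j := by
    intro j hj
    have h1 : ∀ m, bernoulliPoly m 1 = (-1) ^ m * (bernoulli m : ℂ) := fun m => by
      have := bernoulliPoly_one_sub m 0
      rwa [sub_zero, bernoulliPoly_zero] at this
    have h2 : (-1 : ℂ) ^ j * (-1) ^ (k - j) = 1 := by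
      rw [← pow_add, Nat.add_sub_cancel' hj, hk2.neg_one_pow]
    rw [sub_zero, h1, h1, bernoulliProd]
    linear_combination ((bernoulli j : ℂ) / (j.factorial : ℂ)
      * ((bernoulli (k - j) : ℂ) / ((k - j).factorial : ℂ))) * h2
  have e3 : ∀ j, j ≤ k → bernoulliPoly j (1 - 1) / j.factorial
      * (bernoulliPoly (k - j) 0 / (k - j).factorial) = bernoulliProd k j := by
    intro j _
    rw [sub_self, bernoulliPoly_zero, bernoulliPoly_zero, bernoulliProd]
  have hcongr : ∀ {A B : ℕ → ℂ} (x y : ℂ), (∀ j, j ≤ k → A j = B j) →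
      homog k A x y = homog k B x y := fun x y h =>
    Finset.sum_congr rfl fun j hj => by rw [h j (Nat.lt_succ_iff.1 (Finset.mem_range.1 hj))]
  rwa [hcongr _ _ e1, hcongr _ _ e2, hcongr _ _ e3, one_mul] at this

/-! ### The completed L-function of the Eisenstein series -/

lemma LSeriesHasSum_pow (m : ℕ) {s : ℂ} (hs : (m : ℝ) + 1 < s.re) :
    LSeriesHasSum (fun n => ((ArithmeticFunction.pow m n : ℕ) : ℂ)) s (riemannZeta (s - m)) := by
  have h := LSeriesHasSum_one (s := s - m) (by simpa using by linarith)
  rw [LSeriesHasSum] at h ⊢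
  convert h using 1
  ext n
  rcases eq_or_ne n 0 with rfl | hn
  · simp
  · have hn' : (n : ℂ) ≠ 0 := Nat.cast_ne_zero.2 hn
    rw [LSeries.term_of_ne_zero hn, LSeries.term_of_ne_zero hn, Complex.cpow_sub _ _ hn',
      Complex.cpow_natCast, Pi.one_apply, ArithmeticFunction.pow_apply, if_neg (by tauto)]
    have := pow_ne_zero m hn'
    push_cast
    field_simp

lemma LSeriesHasSum_sigma (m : ℕ) {s : ℂ} (hs : (m : ℝ) + 1 < s.re) :
    LSeriesHasSum (fun n => ((ArithmeticFunction.sigma m n : ℕ) : ℂ)) s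
      (riemannZeta s * riemannZeta (s - m)) := by
  have h := LSeriesHasSum.convolution (LSeriesHasSum_one (s := s)
    (by have : (0 : ℝ) ≤ m := m.cast_nonneg; linarith)) (LSeriesHasSum_pow m hs)
  convert h using 1
  rw [LSeries.one_convolution_eq_zeta_convolution]
  ext n
  rw [← ArithmeticFunction.zeta_mul_pow_eq_sigma, LSeries.convolution_def,
    ArithmeticFunction.mul_apply]
  push_cast
  rfl

/-- Euler's formula would otherwise make `ζ(k)` vanish. This lets `B_k` cancel between the scaling
factor of `eisensteinG` and the coefficients of `E`. -/
lemma bernoulli_ne_zero_of_even {k : ℕ} (hk : 3 ≤ k) (hk2 : Even k) : bernoulli k ≠ 0 := by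
  intro h
  obtain ⟨m, rfl⟩ := hk2
  have hz := riemannZeta_two_mul_nat (k := m) (by omega)
  rw [two_mul m, h] at hz
  refine riemannZeta_ne_zero_of_one_lt_re (s := 2 * (m : ℂ)) ?_ (by simpa using hz)
  have : (3 : ℝ) ≤ m + m := by exact_mod_cast hk
  simp
  linarith

lemma analyticAt_cuspFunction_one (k : ℤ) (f : ModularForm 𝒮ℒ k) :
    AnalyticAt ℂ (cuspFunction 1 f) 0 :=
  ModularFormClass.analyticAt_cuspFunction_zero f one_pos one_mem_strictPeriods_SL

lemma coeff_qExpansion_eisensteinG {k : ℕ} (hk : 3 ≤ k) (hk2 : Even k) (m : ℕ) :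
    (qExpansion 1 (eisensteinG hk)).coeff m =
      if m = 0 then -(bernoulli k : ℂ) / (2 * k) else (ArithmeticFunction.sigma (k - 1) m : ℂ) := by
  have h : ⇑(eisensteinG hk) = (-(bernoulli k : ℂ) / (2 * k)) • ⇑(ModularForm.E hk) := rfl
  rw [h, qExpansion_smul (analyticAt_cuspFunction_one _ _), map_smul,
    EisensteinSeries.E_qExpansion_coeff hk hk2]
  have hb : (bernoulli k : ℂ) ≠ 0 := Rat.cast_ne_zero.2 (bernoulli_ne_zero_of_even hk hk2)
  have hk0 : (k : ℂ) ≠ 0 := Nat.cast_ne_zero.2 (by omega)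
  split_ifs
  · simp
  · rw [smul_eq_mul]
    field_simp

lemma valueAtInfty_eisensteinG {k : ℕ} (hk : 3 ≤ k) (hk2 : Even k) :
    valueAtInfty (eisensteinG hk) = -(bernoulli k : ℂ) / (2 * k) := by
  rw [← qExpansion_coeff_zero one_pos (analyticAt_cuspFunction_one _ _)
    (SlashInvariantFormClass.periodic_comp_ofComplex _ one_mem_strictPeriods_SL),
    coeff_qExpansion_eisensteinG hk hk2, if_pos rfl]

/-- The functional-equation pair couples `f` with its translate by `S`; level one makes the pair
self-dual. -/
lemma translate_S_eq {k : ℤ} (f : ModularForm 𝒮ℒ k) :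
    ⇑(ModularForm.translate f (ModularGroup.S : GL (Fin 2) ℝ)) = ⇑f := by
  rw [ModularForm.coe_translate]
  exact SlashInvariantForm.slash_action_eqn f _ ⟨ModularGroup.S, rfl⟩

/-- The functional equation of a modular form of level one and even weight. -/
lemma Lambda_weight_sub {k : ℤ} (hk : 0 < k) (hk2 : Even k) (f : ModularForm 𝒮ℒ k) (s : ℂ) :
    ModularForm.Λ hk f (k - s) = Complex.I ^ k * ModularForm.Λ hk f s := by
  have h := (ModularForm.weakFEPair hk f).functional_equation s
  have hI : (Complex.I ^ k)⁻¹ = Complex.I ^ k := by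
    rw [← inv_zpow, Complex.inv_I, hk2.neg_zpow]
  have hsymm : (ModularForm.weakFEPair hk f).symm.Λ s = (ModularForm.weakFEPair hk f).Λ s := by
    simp only [WeakFEPair.Λ, WeakFEPair.Λ₀, WeakFEPair.f_modif, WeakFEPair.symm,
      ModularForm.weakFEPair, translate_S_eq, hI]
  rw [hsymm] at h
  simpa [ModularForm.Λ] using h

/-- The completed `L`-function of the Eisenstein series in the region of absolute convergence. -/
lemma Lambda_eisensteinG_of_lt_re {k : ℕ} (hk : 3 ≤ k) (hk2 : Even k) (hk0 : (0 : ℤ) < k) {s : ℂ}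
    (hs : (k : ℝ) + 1 < s.re) :
    ModularForm.Λ hk0 (eisensteinG hk) s = (2 * Real.pi) ^ (-s) * Complex.Gamma s *
      (riemannZeta s * riemannZeta (s - (k - 1))) := by
  have hkc : ((k - 1 : ℕ) : ℂ) = k - 1 := by push_cast [show 1 ≤ k by omega]; ring
  have hσ := LSeriesHasSum_sigma (k - 1) (s := s) (by push_cast [show 1 ≤ k by omega]; linarith)
  have hL := ModularForm.hasSum_L hk0 (eisensteinG hk) (s := s) (by simpa using hs)
  have hs0 : 0 < s.re := by have : (0 : ℝ) ≤ k := k.cast_nonneg; linarith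
  have hsne : s ≠ 0 := fun h => by simp [h] at hs0
  rw [Subgroup.strictWidthInfty_SL2Z] at hL
  have hu := hσ.unique (by
    convert hL using 2 with n
    rcases eq_or_ne n 0 with rfl | hn
    · simp [hsne]
    · rw [LSeries.term_of_ne_zero hn, coeff_qExpansion_eisensteinG hk hk2, if_neg hn])
  rw [ModularForm.L, Complex.Gammaℂ_def, hkc] at hu
  rw [hu]
  have h1 := Complex.Gamma_ne_zero_of_re_pos hs0
  have h2 : (2 * (Real.pi : ℂ)) ^ (-s) ≠ 0 := by
    rw [Complex.cpow_ne_zero_iff]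
    left
    simp [Real.pi_ne_zero]
  simp only [Complex.ofReal_one, Complex.one_cpow]
  field_simp

/-- The completed `L`-function of the Eisenstein series at the integers inside the critical strip
to the right of `1`. -/
lemma Lambda_eisensteinG_nat {k : ℕ} (hk : 3 ≤ k) (hk2 : Even k) (hk0 : (0 : ℤ) < k) {j : ℕ}
    (hj : 2 ≤ j) (hjk : j < k) :
    ModularForm.Λ hk0 (eisensteinG hk) j = (2 * Real.pi) ^ (-(j : ℂ)) * Complex.Gamma j *
      (riemannZeta j * riemannZeta (j - (k - 1))) := by
  set F : ℂ → ℂ := ModularForm.Λ hk0 (eisensteinG hk)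
  set G : ℂ → ℂ := fun s => (2 * Real.pi) ^ (-s) * Complex.Gamma s *
      (riemannZeta s * riemannZeta (s - (k - 1)))
  have hpi : (2 * Real.pi : ℂ) ≠ 0 := by simp [Real.pi_ne_zero]
  have hF : ∀ s : ℂ, 1 < s.re → s ≠ k → DifferentiableAt ℂ F s := by
    intro s hs hsk
    refine (ModularForm.weakFEPair hk0 (eisensteinG hk)).differentiableAt_Λ (Or.inl ?_) (Or.inl ?_)
    · rintro rfl
      simp at hs
      linarith
    · simpa using hsk
  have hG : ∀ s : ℂ, 1 < s.re → s ≠ k → DifferentiableAt ℂ G s := by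
    intro s hs hsk
    have h1 : DifferentiableAt ℂ Complex.Gamma s := by
      refine Complex.differentiableAt_Gamma _ fun m h => ?_
      rw [h] at hs
      simp at hs
      have : (0 : ℝ) ≤ m := m.cast_nonneg
      linarith
    have h2 : DifferentiableAt ℂ riemannZeta s := differentiableAt_riemannZeta (by
      rintro rfl
      simp at hs)
    have h3 : DifferentiableAt ℂ (fun s : ℂ => riemannZeta (s - (k - 1))) s :=
      DifferentiableAt.comp s (differentiableAt_riemannZeta (by
        intro h
        exact hsk (by linear_combination h))) (by fun_prop)
    exact (((differentiableAt_id.neg).const_cpow (Or.inl hpi)).mul h1).mul (h2.mul h3)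
  -- A convex open region on which the identity theorem applies: it avoids the real pole `s = k`,
  -- meets the half-plane of absolute convergence, and has `j` in its closure.
  set U : Set ℂ := {s | 1 < s.re} ∩ {s | 0 < s.im}
  have hUo : IsOpen U :=
    (isOpen_lt continuous_const Complex.continuous_re).inter
      (isOpen_lt continuous_const Complex.continuous_im)
  have hUc : IsPreconnected U :=
    ((convex_halfSpace_re_gt 1).inter (convex_halfSpace_im_gt 0)).isPreconnected
  have hUk : ∀ s ∈ U, s ≠ k := by
    rintro s ⟨-, hs⟩ rfl
    simp at hs
  have hUF : AnalyticOnNhd ℂ F U := DifferentiableOn.analyticOnNhd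
    (fun s hs => (hF s hs.1 (hUk s hs)).differentiableWithinAt) hUo
  have hUG : AnalyticOnNhd ℂ G U := DifferentiableOn.analyticOnNhd
    (fun s hs => (hG s hs.1 (hUk s hs)).differentiableWithinAt) hUo
  have hz : ((k : ℂ) + 2 + Complex.I) ∈ U := by
    have : (0 : ℝ) ≤ k := k.cast_nonneg
    constructor
    · simp
      linarith
    · simp
  have hEq : Set.EqOn F G U := by
    refine hUF.eqOn_of_preconnected_of_eventuallyEq hUG hUc hz ?_
    have : {s : ℂ | (k : ℝ) + 1 < s.re} ∈ nhds ((k : ℂ) + 2 + Complex.I) :=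
      (isOpen_lt continuous_const Complex.continuous_re).mem_nhds (by simp)
    filter_upwards [this] with s hs
    exact Lambda_eisensteinG_of_lt_re hk hk2 hk0 hs
  have hjre : 1 < (j : ℂ).re := by
    rw [Complex.natCast_re]
    exact_mod_cast hj
  have hjk' : (j : ℂ) ≠ k := fun h => hjk.ne (Nat.cast_injective h)
  have hcl : (j : ℂ) ∈ closure U := by
    have ht : Filter.Tendsto (fun x : ℝ => (j : ℂ) + x * Complex.I) (nhdsWithin 0 (Set.Ioi 0))
        (nhds (j : ℂ)) := by
      have : Continuous fun x : ℝ => (j : ℂ) + x * Complex.I := by fun_prop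
      simpa using (this.tendsto 0).mono_left nhdsWithin_le_nhds
    refine mem_closure_of_tendsto ht ?_
    filter_upwards [self_mem_nhdsWithin] with x hx
    refine ⟨by simpa using hjre, by simpa using hx⟩
  have hne : (nhdsWithin (j : ℂ) U).NeBot := mem_closure_iff_nhdsWithin_neBot.1 hcl
  refine tendsto_nhds_unique
    ((hF j hjre hjk').continuousAt.tendsto.mono_left (nhdsWithin_le_nhds (s := U))) ?_
  refine ((hG j hjre hjk').continuousAt.tendsto.mono_left (nhdsWithin_le_nhds (s := U))).congr' ?_
  filter_upwards [self_mem_nhdsWithin] with s hs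
  exact (hEq hs).symm

/-! ### The regularized period as a sum of Mellin moments -/

lemma I_mul_sub_pow (N : ℕ) (t z : ℂ) :
    (Complex.I * t - z) ^ N * Complex.I = ∑ m ∈ Finset.range (N + 1),
      ((N.choose m : ℂ) * (-z) ^ (N - m) * Complex.I ^ (m + 1)) * t ^ m := by
  rw [sub_eq_add_neg, add_pow, Finset.sum_mul]
  refine Finset.sum_congr rfl fun m _ => ?_
  rw [mul_pow]
  ring

section Moments

variable (P : WeakFEPair ℂ)

/-- The modified function belongs to a strong functional-equation pair, so its Mellin transform
converges everywhere; the moment `t^m` is the point `s = m + 1`. -/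
lemma integrableOn_pow_mul_f_modif (m : ℕ) :
    IntegrableOn (fun t : ℝ => (t : ℂ) ^ m * P.f_modif t) (Set.Ioi 0) := by
  have h := (P.isStrongFEPair_toStrongFEPair.hasMellin ((m : ℂ) + 1)).1
  refine IntegrableOn.congr_fun h (fun t _ => ?_) measurableSet_Ioi
  simp only [add_sub_cancel_right, Complex.cpow_natCast, smul_eq_mul]
  rfl

lemma integral_pow_mul_f_modif (m : ℕ) :
    ∫ t in Set.Ioi (0 : ℝ), (t : ℂ) ^ m * P.f_modif t = P.Λ₀ ((m : ℂ) + 1) := by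
  rw [WeakFEPair.Λ₀, mellin]
  refine setIntegral_congr_fun measurableSet_Ioi fun t _ => ?_
  simp only [add_sub_cancel_right, Complex.cpow_natCast, smul_eq_mul]

lemma f_modif_mul_kernel (N : ℕ) (z : ℂ) (t : ℝ) :
    P.f_modif t * (Complex.I * t - z) ^ N * Complex.I = ∑ m ∈ Finset.range (N + 1),
      ((N.choose m : ℂ) * (-z) ^ (N - m) * Complex.I ^ (m + 1)) * ((t : ℂ) ^ m * P.f_modif t) := by
  rw [mul_assoc, I_mul_sub_pow, Finset.mul_sum]
  exact Finset.sum_congr rfl fun m _ => by ring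

lemma integrableOn_f_modif_mul_kernel (N : ℕ) (z : ℂ) :
    IntegrableOn (fun t : ℝ => P.f_modif t * (Complex.I * t - z) ^ N * Complex.I)
      (Set.Ioi 0) := by
  simp only [f_modif_mul_kernel]
  exact integrable_finsetSum _ fun m _ => (integrableOn_pow_mul_f_modif P m).const_mul _

lemma integral_f_modif_mul_kernel (N : ℕ) (z : ℂ) :
    ∫ t in Set.Ioi (0 : ℝ), P.f_modif t * (Complex.I * t - z) ^ N * Complex.I
      = ∑ m ∈ Finset.range (N + 1),
        ((N.choose m : ℂ) * (-z) ^ (N - m) * Complex.I ^ (m + 1)) * P.Λ₀ ((m : ℂ) + 1) := by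
  simp only [f_modif_mul_kernel]
  rw [integral_finsetSum _ fun m _ => (integrableOn_pow_mul_f_modif P m).const_mul _]
  exact Finset.sum_congr rfl fun m _ => by rw [integral_const_mul, integral_pow_mul_f_modif]

end Moments

lemma I_pow_inv_of_even {k : ℕ} (hk2 : Even k) : ((Complex.I ^ k)⁻¹ : ℂ) = Complex.I ^ k := by
  rw [← inv_pow, Complex.inv_I, hk2.neg_pow]

lemma upperIntegrand_eq {k : ℕ} (hk0 : (0 : ℤ) < k) (f : ModularForm 𝒮ℒ k)
    (z : ℂ) {t : ℝ} (ht : t ∈ Set.Ioi (1 : ℝ)) :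
    upperIntegrand k f z t = (ModularForm.weakFEPair hk0 f).f_modif t
      * (Complex.I * t - z) ^ (k - 2) * Complex.I := by
  have h : t ∉ Set.Ioo (0 : ℝ) 1 := fun h => absurd h.2 (not_lt.2 (le_of_lt ht))
  simp only [WeakFEPair.f_modif, Pi.add_apply, Set.indicator_of_mem ht, Set.indicator_of_notMem h,
    add_zero]
  rfl

/-- The modification of `f` below `1` subtracts `i^k a₀ t^(-k)`, which is `a₀ / (it)^k` because
`i^(-k) = i^k` for even `k`. -/
lemma lowerIntegrand_eq {k : ℕ} (hk0 : (0 : ℤ) < k) (f : ModularForm 𝒮ℒ k)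
    (hk2 : Even k) (z : ℂ) {t : ℝ} (ht : t ∈ Set.Ioo (0 : ℝ) 1) :
    lowerIntegrand k f z t = (ModularForm.weakFEPair hk0 f).f_modif t
      * (Complex.I * t - z) ^ (k - 2) * Complex.I := by
  have h : t ∉ Set.Ioi (1 : ℝ) := fun h => absurd ht.2 (not_lt.2 (le_of_lt h))
  simp only [WeakFEPair.f_modif, Pi.add_apply, Set.indicator_of_mem ht, Set.indicator_of_notMem h,
    zero_add, ModularForm.weakFEPair, translate_S_eq, lowerIntegrand, onAxis, smul_eq_mul]
  congr 3
  rw [mul_pow, div_eq_inv_mul, mul_inv, I_pow_inv_of_even hk2, Int.cast_natCast,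
    Real.rpow_neg ht.1.le, Real.rpow_natCast, zpow_natCast]
  push_cast
  rfl

lemma continuousOn_onAxis {k : ℕ} (f : ModularForm 𝒮ℒ k) : ContinuousOn (onAxis f) (Set.Ioi 0) := by
  unfold onAxis
  fun_prop

lemma continuousOn_upperIntegrand {k : ℕ} (f : ModularForm 𝒮ℒ k) (z : ℂ) :
    ContinuousOn (upperIntegrand k f z) (Set.Ioi 0) := by
  have := continuousOn_onAxis f
  unfold upperIntegrand
  fun_prop

lemma continuousOn_lowerIntegrand {k : ℕ} (f : ModularForm 𝒮ℒ k) (z : ℂ) :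
    ContinuousOn (lowerIntegrand k f z) (Set.Ioi 0) := by
  have := continuousOn_onAxis f
  have h2 : ContinuousOn (fun t : ℝ => valueAtInfty f / (Complex.I * t) ^ k) (Set.Ioi 0) := by
    refine continuousOn_const.div (by fun_prop) fun t ht => ?_
    exact pow_ne_zero _ (mul_ne_zero Complex.I_ne_zero
      (Complex.ofReal_ne_zero.2 (ne_of_gt ht)))
  unfold lowerIntegrand
  fun_prop

lemma integrableOn_upperIntegrand {k : ℕ} (hk0 : (0 : ℤ) < k) (f : ModularForm 𝒮ℒ k)
    (z : ℂ) {t₀ : ℝ} (ht₀ : 0 < t₀) :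
    IntegrableOn (upperIntegrand k f z) (Set.Ioi t₀) := by
  have h1 : IntegrableOn (upperIntegrand k f z) (Set.Ioi 1) :=
    ((integrableOn_f_modif_mul_kernel (ModularForm.weakFEPair hk0 f) (k - 2) z).mono_set
      (Set.Ioi_subset_Ioi zero_le_one)).congr_fun
      (fun t ht => (upperIntegrand_eq hk0 f z ht).symm) measurableSet_Ioi
  -- Between the cut and `1` the integrand is continuous on a compact interval, so only the range
  -- beyond `1` needs decay.
  have h2 : IntegrableOn (upperIntegrand k f z) (Set.Icc t₀ 1) :=
    ((continuousOn_upperIntegrand f z).mono fun t ht => ht₀.trans_le ht.1).integrableOn_Icc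
  refine (h2.union h1).mono_set fun t ht => ?_
  rcases le_or_gt t 1 with h | h
  · exact Or.inl ⟨le_of_lt ht, h⟩
  · exact Or.inr h

lemma integrableOn_lowerIntegrand {k : ℕ} (hk0 : (0 : ℤ) < k) (f : ModularForm 𝒮ℒ k)
    (hk2 : Even k) (z : ℂ) (t₀ : ℝ) :
    IntegrableOn (lowerIntegrand k f z) (Set.Ioc 0 t₀) := by
  have h1 : IntegrableOn (lowerIntegrand k f z) (Set.Ioo 0 1) :=
    ((integrableOn_f_modif_mul_kernel (ModularForm.weakFEPair hk0 f) (k - 2) z).mono_set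
      Set.Ioo_subset_Ioi_self).congr_fun
      (fun t ht => (lowerIntegrand_eq hk0 f hk2 z ht).symm) measurableSet_Ioo
  have h2 : IntegrableOn (lowerIntegrand k f z) (Set.Icc 1 t₀) :=
    ((continuousOn_lowerIntegrand f z).mono fun t ht =>
      zero_lt_one.trans_le ht.1).integrableOn_Icc
  refine (h1.union h2).mono_set fun t ht => ?_
  rcases lt_or_ge t 1 with h | h
  · exact Or.inl ⟨ht.1, h⟩
  · exact Or.inr ⟨h, ht.2⟩

/-- The boundary term of the regularized period integral. -/
def boundaryTerm (k : ℕ) (a z : ℂ) (t : ℝ) : ℂ :=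
  a / (k - 1) * ((z - Complex.I * t) ^ (k - 1) + (1 - z / (Complex.I * t)) ^ (k - 1) / z)

/-- In the difference of the integrands `f` cancels, leaving elementary functions of `t` with this
primitive. Hence moving the cut changes the boundary term by exactly what the two integrals lose. -/
lemma hasDerivAt_boundaryTerm {k : ℕ} (f : ModularForm 𝒮ℒ k)
    (hk : 3 ≤ k) (hk2 : Even k) {z : ℂ} (hz : z ≠ 0) {t : ℝ}
    (ht : t ≠ 0) :
    HasDerivAt (boundaryTerm k (valueAtInfty f) z)
      (upperIntegrand k f z t - lowerIntegrand k f z t) t := by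
  obtain ⟨N, rfl⟩ : ∃ N, k = N + 2 := ⟨k - 2, by omega⟩
  have hN : Even N := by simpa [Nat.even_add] using hk2
  have ht' : (t : ℂ) ≠ 0 := Complex.ofReal_ne_zero.2 ht
  have hIt : Complex.I * (t : ℂ) ≠ 0 := mul_ne_zero Complex.I_ne_zero ht'
  have hN1 : (N : ℂ) + 1 ≠ 0 := Nat.cast_add_one_ne_zero N
  have d0 : HasDerivAt (fun t : ℝ => Complex.I * (t : ℂ)) Complex.I t := by
    simpa using (Complex.ofRealCLM.hasDerivAt (x := t)).const_mul Complex.I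
  have d1 := (d0.const_sub z).pow (N + 1)
  have d2 := (((hasDerivAt_const t z).div d0 hIt).const_sub 1).pow (N + 1)
  have d3 := (d1.add (d2.div_const z)).const_mul (valueAtInfty f / (((N + 2 : ℕ) : ℂ) - 1))
  refine d3.congr_deriv ?_
  simp only [upperIntegrand, lowerIntegrand, Nat.add_sub_cancel, Pi.div_apply]
  have e1 : z - Complex.I * t = -(Complex.I * t - z) := by ring
  have e2 : 1 - z / (Complex.I * t) = (Complex.I * t - z) / (Complex.I * t) := by
    field_simp
  rw [e1, hN.neg_pow, e2, div_pow]
  push_cast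
  have e3 : (N : ℂ) + 2 - 1 = N + 1 := by ring
  rw [e3]
  generalize Complex.I * (t : ℂ) = w at *
  generalize hp : (w - z) ^ N = p
  have := pow_ne_zero N hIt
  field_simp
  ring

lemma period_eq_period_one {k : ℕ} (hk0 : (0 : ℤ) < k) (f : ModularForm 𝒮ℒ k)
    (hk : 3 ≤ k) (hk2 : Even k) {z : ℂ} (hz : z ≠ 0) {t₀ : ℝ}
    (ht₀ : 0 < t₀) : period k f t₀ z = period k f 1 z := by
  have hsub : Set.uIcc t₀ 1 ⊆ Set.Ioi 0 := fun t ht =>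
    (lt_min ht₀ zero_lt_one).trans_le ht.1
  have hu : IntervalIntegrable (upperIntegrand k f z) volume t₀ 1 :=
    ((continuousOn_upperIntegrand f z).mono hsub).intervalIntegrable
  have hl : IntervalIntegrable (lowerIntegrand k f z) volume t₀ 1 :=
    ((continuousOn_lowerIntegrand f z).mono hsub).intervalIntegrable
  have h1 := intervalIntegral.integral_interval_add_Ioi
    (integrableOn_upperIntegrand hk0 f z ht₀) (integrableOn_upperIntegrand hk0 f z one_pos)
  have h2 : (∫ t in (0 : ℝ)..t₀, lowerIntegrand k f z t)
      + (∫ t in t₀..1, lowerIntegrand k f z t) = ∫ t in (0 : ℝ)..1, lowerIntegrand k f z t :=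
    intervalIntegral.integral_add_adjacent_intervals
      ((intervalIntegrable_iff_integrableOn_Ioc_of_le ht₀.le).2
        (integrableOn_lowerIntegrand hk0 f hk2 z t₀)) hl
  have h3 := intervalIntegral.integral_eq_sub_of_hasDerivAt
    (fun t ht => hasDerivAt_boundaryTerm f hk hk2 hz (ne_of_gt (hsub ht))) (hu.sub hl)
  rw [intervalIntegral.integral_sub hu hl] at h3
  rw [intervalIntegral.integral_of_le ht₀.le, intervalIntegral.integral_of_le zero_le_one] at h2
  have hp : ∀ t : ℝ, period k f t z = (∫ t in Set.Ioi t, upperIntegrand k f z t)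
      + (∫ t in Set.Ioc 0 t, lowerIntegrand k f z t)
      + boundaryTerm k (valueAtInfty f) z t := fun _ => rfl
  rw [hp, hp]
  linear_combination h3 - h1 + h2

lemma period_one_eq {k : ℕ} (hk0 : (0 : ℤ) < k) (f : ModularForm 𝒮ℒ k) (hk2 : Even k) (z : ℂ) :
    period k f 1 z = (∑ m ∈ Finset.range (k - 2 + 1),
        (((k - 2).choose m : ℂ) * (-z) ^ (k - 2 - m) * Complex.I ^ (m + 1))
          * (ModularForm.weakFEPair hk0 f).Λ₀ ((m : ℂ) + 1))
      + boundaryTerm k (valueAtInfty f) z 1 := by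
  have hint := integrableOn_f_modif_mul_kernel (ModularForm.weakFEPair hk0 f) (k - 2) z
  rw [← integral_f_modif_mul_kernel]
  have hd : Set.Ioi (0 : ℝ) = Set.Ioi 1 ∪ Set.Ioc 0 1 := by
    rw [Set.union_comm, Set.Ioc_union_Ioi_eq_Ioi zero_le_one]
  have hdisj : Disjoint (Set.Ioi (1 : ℝ)) (Set.Ioc 0 1) :=
    Set.disjoint_left.2 fun t h1 h2 => absurd h2.2 (not_le.2 h1)
  rw [hd, setIntegral_union hdisj
    measurableSet_Ioc (hint.mono_set (by rw [hd]; exact Set.subset_union_left))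
    (hint.mono_set (by rw [hd]; exact Set.subset_union_right)),
    setIntegral_congr_fun measurableSet_Ioi fun t ht => (upperIntegrand_eq hk0 f z ht).symm,
    -- The comparison with the modified function below `1` covers only the open interval; the
    -- endpoint is a null set.
    integral_Ioc_eq_integral_Ioo,
    setIntegral_congr_fun measurableSet_Ioo fun t ht => (lowerIntegrand_eq hk0 f hk2 z ht).symm,
    ← integral_Ioc_eq_integral_Ioo]
  rfl

/-- These summands are the polar terms separating `Λ₀` from `Λ`. Dividing `N.choose m` by `m + 1` or
`N + 1 - m` gives binomials of order `N + 1` over `N + 1`, so each sum is a multiple of `(i -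
z)^(N+1)` short of one end term. The full powers cancel the boundary term; the end terms yield
`z^(k-1)` and `1/z`. -/
lemma boundaryTerm_one_add_sum {k : ℕ} (hk : 3 ≤ k) (hk2 : Even k) (a : ℂ) {z : ℂ} (hz : z ≠ 0) :
    (∑ m ∈ Finset.range (k - 2 + 1),
        (((k - 2).choose m : ℂ) * (-z) ^ (k - 2 - m) * Complex.I ^ (m + 1))
          * (a / (m + 1) + Complex.I ^ k * a / (k - (m + 1))))
      + boundaryTerm k a z 1 = a / (k - 1) * (z ^ (k - 1) + 1 / z) := by
  obtain ⟨N, rfl⟩ : ∃ N, k = N + 2 := ⟨k - 2, by omega⟩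
  have hN : Even N := by simpa [Nat.even_add] using hk2
  have hN1 : (N : ℂ) + 1 ≠ 0 := Nat.cast_add_one_ne_zero N
  -- Two copies of the expansion: `b1` will split off the lowest power of `i`, `b2` the highest.
  have b1 := add_pow Complex.I (-z) (N + 1)
  have b2 := b1
  rw [Finset.sum_range_succ'] at b1
  rw [Finset.sum_range_succ] at b2
  have s1 : ∑ m ∈ Finset.range (N + 1), ((N.choose m : ℂ) * (-z) ^ (N - m) * Complex.I ^ (m + 1))
      * (1 / ((m : ℂ) + 1)) = (1 / ((N : ℂ) + 1)) * ∑ m ∈ Finset.range (N + 1),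
        Complex.I ^ (m + 1) * (-z) ^ (N + 1 - (m + 1)) * ((N + 1).choose (m + 1) : ℂ) := by
    rw [Finset.mul_sum]
    refine Finset.sum_congr rfl fun m _ => ?_
    have h : ((N : ℂ) + 1) * (N.choose m : ℂ) = ((N + 1).choose (m + 1) : ℂ) * ((m : ℂ) + 1) := by
      exact_mod_cast Nat.add_one_mul_choose_eq N m
    have hm : (m : ℂ) + 1 ≠ 0 := Nat.cast_add_one_ne_zero m
    rw [Nat.add_sub_add_right]
    field_simp
    linear_combination (-z) ^ (N - m) * h
  have s2 : ∑ m ∈ Finset.range (N + 1), ((N.choose m : ℂ) * (-z) ^ (N - m) * Complex.I ^ (m + 1))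
      * (1 / ((N : ℂ) + 1 - m)) = (Complex.I / (-z) / ((N : ℂ) + 1)) * ∑ m ∈ Finset.range (N + 1),
        Complex.I ^ m * (-z) ^ (N + 1 - m) * ((N + 1).choose m : ℂ) := by
    rw [Finset.mul_sum]
    refine Finset.sum_congr rfl fun m hm => ?_
    have hm : m ≤ N := Nat.lt_succ_iff.1 (Finset.mem_range.1 hm)
    have h : ((N : ℂ) + 1) * (N.choose m : ℂ) = ((N + 1).choose m : ℂ) * ((N : ℂ) + 1 - m) := by
      have := Nat.choose_mul_succ_eq N m
      have h2 : ((N + 1 - m : ℕ) : ℂ) = (N : ℂ) + 1 - m := by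
        push_cast [show m ≤ N + 1 by omega]; ring
      rw [← h2, mul_comm]
      exact_mod_cast this
    have hm' : (N : ℂ) + 1 - m ≠ 0 := by
      have : ((N + 1 - m : ℕ) : ℂ) ≠ 0 := Nat.cast_ne_zero.2 (by omega)
      rwa [Nat.cast_sub (by omega), Nat.cast_add, Nat.cast_one] at this
    rw [show N + 1 - m = N - m + 1 by omega]
    field_simp
    linear_combination z * Complex.I ^ (m + 1) * (-z) ^ (N - m) * h
  have hsum : ∑ m ∈ Finset.range (N + 1), ((N.choose m : ℂ) * (-z) ^ (N - m) * Complex.I ^ (m + 1))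
      * (a / (m + 1) + Complex.I ^ (N + 2) * a / (((N + 2 : ℕ) : ℂ) - (m + 1)))
      = a * (∑ m ∈ Finset.range (N + 1), ((N.choose m : ℂ) * (-z) ^ (N - m) * Complex.I ^ (m + 1))
          * (1 / ((m : ℂ) + 1)))
        + a * Complex.I ^ (N + 2) * ∑ m ∈ Finset.range (N + 1),
          ((N.choose m : ℂ) * (-z) ^ (N - m) * Complex.I ^ (m + 1)) * (1 / ((N : ℂ) + 1 - m)) := by
    rw [Finset.mul_sum, Finset.mul_sum, ← Finset.sum_add_distrib]
    refine Finset.sum_congr rfl fun m _ => ?_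
    push_cast
    rw [show (N : ℂ) + 2 - (m + 1) = N + 1 - m by ring]
    ring
  rw [Nat.add_sub_cancel, hsum, s1, s2, eq_sub_of_add_eq b1.symm, eq_sub_of_add_eq b2.symm,
    boundaryTerm, show N + 2 - 1 = N + 1 by omega]
  have hodd : Odd (N + 1) := hN.add_one
  have e1 : z - Complex.I * ((1 : ℝ) : ℂ) = -(Complex.I + -z) := by
    push_cast
    ring
  have e2 : 1 - z / (Complex.I * ((1 : ℝ) : ℂ)) = -(Complex.I * (Complex.I + -z)) := by
    push_cast
    field_simp
    linear_combination (Complex.I - z) * Complex.I_sq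
  rw [e1, e2, hodd.neg_pow, hodd.neg_pow, mul_pow]
  have hI : Complex.I ^ N * Complex.I ^ N = 1 := by
    rw [← mul_pow, Complex.I_mul_I, hN.neg_one_pow]
  simp only [pow_succ, Nat.sub_self, Nat.sub_zero, Nat.choose_self, Nat.choose_zero_right, pow_zero,
    hN.neg_pow]
  push_cast
  rw [show (N : ℂ) + 2 - 1 = N + 1 by ring]
  generalize (Complex.I + -z) ^ N = p
  generalize Complex.I ^ N = q at *
  field_simp
  linear_combination (a * z * p * Complex.I * q - a * p * q * Complex.I ^ 2
    + a * (Complex.I ^ 2 - 1)) * Complex.I_sq + a * Complex.I ^ 4 * hI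

/-- The period function in terms of the values of the completed `L`-function in the critical
strip. -/
theorem period_eq_sum_Lambda {k : ℕ} (hk0 : (0 : ℤ) < k) (f : ModularForm 𝒮ℒ k)
    (hk : 3 ≤ k) (hk2 : Even k) {z : ℂ} (hz : z ≠ 0) {t₀ : ℝ}
    (ht₀ : 0 < t₀) :
    period k f t₀ z = (∑ m ∈ Finset.range (k - 2 + 1),
        (((k - 2).choose m : ℂ) * (-z) ^ (k - 2 - m) * Complex.I ^ (m + 1))
          * ModularForm.Λ hk0 f ((m : ℂ) + 1))
      + valueAtInfty f / (k - 1) * (z ^ (k - 1) + 1 / z) := by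
  rw [period_eq_period_one hk0 f hk hk2 hz ht₀, period_one_eq hk0 f hk2,
    ← boundaryTerm_one_add_sum hk hk2 _ hz, ← add_assoc, ← Finset.sum_add_distrib]
  congr 1
  refine Finset.sum_congr rfl fun m _ => ?_
  rw [← mul_add]
  congr 1
  have hg₀ : (ModularForm.weakFEPair hk0 f).g₀ = valueAtInfty f :=
    congrArg valueAtInfty (translate_S_eq f)
  have hf₀ : (ModularForm.weakFEPair hk0 f).f₀ = valueAtInfty f := rfl
  have hε : (ModularForm.weakFEPair hk0 f).ε = Complex.I ^ k := zpow_natCast _ _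
  have hw : ((ModularForm.weakFEPair hk0 f).k : ℂ) = k := by simp
  rw [WeakFEPair.Λ₀_eq, hg₀, hf₀, hε, hw, smul_eq_mul, smul_eq_mul, ModularForm.Λ]
  ring

/-! ### Zeta values and the coefficients of the period function -/

/-- The `ζ(k-1)`-coefficient in the period function of the Eisenstein series. -/
def zetaCoeff (k : ℕ) : ℂ :=
  riemannZeta ((k : ℂ) - 1) / (2 * Real.pi * Complex.I) ^ (k - 1)

lemma two_pi_ne_zero : (2 * Real.pi : ℂ) ≠ 0 := by simp [Real.pi_ne_zero]

lemma even_sub_two {k : ℕ} (hk2 : Even k) : Even (k - 2) := by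
  obtain ⟨m, rfl⟩ := hk2
  exact ⟨m - 1, by omega⟩

lemma Lambda_eisensteinG_add_one {k : ℕ} (hk : 3 ≤ k) (hk2 : Even k) (hk0 : (0 : ℤ) < k) {m : ℕ}
    (hm : 1 ≤ m) (hmk : m + 1 < k) :
    ModularForm.Λ hk0 (eisensteinG hk) (m + 1) = m.factorial / (2 * Real.pi) ^ (m + 1) *
      (riemannZeta (m + 1) * riemannZeta (-((k - 2 - m : ℕ) : ℂ))) := by
  have h := Lambda_eisensteinG_nat hk hk2 hk0 (j := m + 1) (by omega) hmk
  rw [Complex.cpow_neg, Complex.cpow_natCast] at h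
  push_cast at h
  rw [Complex.Gamma_nat_eq_factorial] at h
  rw [h, Nat.cast_sub (by omega), Nat.cast_sub (by omega),
    show (m : ℂ) + 1 - (k - 1) = -(k - (2 : ℕ) - m) by push_cast; ring]
  ring

/-- The product of zeta values attached to an even integer in the critical strip. -/
lemma zeta_mul_zeta_eq_bernoulli (a b : ℕ) :
    ((2 * a + 2 * b + 2).choose (2 * a + 1) : ℂ) * (-1) ^ (2 * b + 1) * Complex.I ^ (2 * a + 2)
      * ((2 * a + 1).factorial / (2 * Real.pi) ^ (2 * a + 2)
        * (riemannZeta (2 * ((a + 1 : ℕ) : ℂ)) * riemannZeta (-((2 * b + 1 : ℕ) : ℂ))))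
      = -((2 * a + 2 * b + 2).factorial : ℂ) / 2
        * ((bernoulli (2 * b + 2) : ℂ) / (2 * b + 2).factorial
          * ((bernoulli (2 * a + 2) : ℂ) / (2 * a + 2).factorial)) := by
  rw [riemannZeta_two_mul_nat (k := a + 1) (by omega), riemannZeta_neg_nat_eq_bernoulli,
    show 2 * (a + 1) = 2 * a + 2 by ring, show 2 * a + 2 - 1 = 2 * a + 1 by omega,
    show 2 * b + 1 + 1 = 2 * b + 2 by ring, show 2 * a + 2 = 2 * (a + 1) by ring,
    pow_mul Complex.I, Complex.I_sq]
  have hf : ((2 * b + 2).factorial : ℂ) = (2 * b + 2) * (2 * b + 1).factorial := by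
    rw [Nat.factorial_succ (2 * b + 1)]
    push_cast
    ring
  have hc : ((2 * a + 2 * b + 2).choose (2 * a + 1) : ℂ) * (2 * a + 1).factorial
      * (2 * b + 1).factorial = (2 * a + 2 * b + 2).factorial := by
    have := Nat.choose_mul_factorial_mul_factorial (n := 2 * a + 2 * b + 2) (k := 2 * a + 1)
      (by omega)
    rw [show 2 * a + 2 * b + 2 - (2 * a + 1) = 2 * b + 1 by omega] at this
    exact_mod_cast this
  have hodd : (-1 : ℂ) ^ (2 * b + 1) = -1 := Odd.neg_one_pow ⟨b, rfl⟩
  have hpi : (Real.pi : ℂ) ≠ 0 := Complex.ofReal_ne_zero.2 Real.pi_ne_zero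
  have h1 : ((2 * b + 1).factorial : ℂ) ≠ 0 := Nat.cast_ne_zero.2 (Nat.factorial_ne_zero _)
  have h2 : ((2 * (a + 1)).factorial : ℂ) ≠ 0 := Nat.cast_ne_zero.2 (Nat.factorial_ne_zero _)
  have h3 : (2 * (b : ℂ) + 2) ≠ 0 := by exact_mod_cast Nat.succ_ne_zero (2 * b + 1)
  have hs : (-1 : ℂ) ^ (a + 1) * (-1) ^ (a + 1 + 1) = -1 := by
    rw [← pow_add]
    exact Odd.neg_one_pow ⟨a + 1, by ring⟩
  rw [hodd, hf, ← hc, mul_pow]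
  push_cast
  rw [show (2 : ℂ) * b + 1 + 1 = 2 * b + 2 by ring,
    show (2 : ℂ) ^ (2 * (a + 1)) = 2 ^ (2 * a + 1) * 2 by ring]
  field_simp
  linear_combination ((2 * a + 2 * b + 2).choose (2 * a + 1) * (2 * a + 1).factorial
    * bernoulli (2 * (a + 1)) * bernoulli (2 * b + 2) : ℂ) * hs

/-- For odd `m`, Euler's formula and the zeta values at negative odd integers give the Bernoulli
product. For even `m` strictly inside the range, a trivial zero of `ζ` matches the vanishing
product. At `m = k-2` the factor `ζ(0) = -1/2` leaves `ζ(k-1)`. At `m = 0` the product formula would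
meet the pole of `ζ` at `1`, so the value comes from the functional equation. -/
lemma choose_mul_Lambda_eisensteinG {k : ℕ} (hk : 3 ≤ k) (hk2 : Even k) (hk0 : (0 : ℤ) < k)
    {m : ℕ} (hm : m ≤ k - 2) :
    ((k - 2).choose m : ℂ) * (-1) ^ (k - 2 - m) * Complex.I ^ (m + 1)
        * ModularForm.Λ hk0 (eisensteinG hk) (m + 1)
      = -((k - 2).factorial : ℂ) / 2 * (bernoulliProd k (k - 1 - m)
        + (if m = 0 then zetaCoeff k else 0) - (if m = k - 2 then zetaCoeff k else 0)) := by
  have htop : ModularForm.Λ hk0 (eisensteinG hk) ((k : ℂ) - 1)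
      = -((k - 2).factorial : ℂ) / 2 * (riemannZeta ((k : ℂ) - 1) / (2 * Real.pi) ^ (k - 1)) := by
    have h := Lambda_eisensteinG_add_one hk hk2 hk0 (m := k - 2) (by omega) (by omega)
    have e : (((k - 2 : ℕ) : ℂ) + 1) = k - 1 := by
      rw [Nat.cast_sub (by omega)]
      push_cast
      ring
    rw [e, Nat.sub_self, Nat.cast_zero, neg_zero, riemannZeta_zero,
      show k - 2 + 1 = k - 1 by omega] at h
    rw [h]
    ring
  have hIk : Complex.I ^ (k - 1) * Complex.I ^ (k - 1) = -1 := by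
    rw [← mul_pow, Complex.I_mul_I]
    exact Odd.neg_one_pow (Nat.Even.sub_odd (by omega) hk2 odd_one)
  have hInv : zetaCoeff k
      = -Complex.I ^ (k - 1) * (riemannZeta ((k : ℂ) - 1) / (2 * Real.pi) ^ (k - 1)) := by
    have hI0 : Complex.I ^ (k - 1) ≠ 0 := pow_ne_zero _ Complex.I_ne_zero
    have h2 := pow_ne_zero (k - 1) two_pi_ne_zero
    rw [zetaCoeff, mul_pow _ Complex.I]
    field_simp
    linear_combination riemannZeta ((k : ℂ) - 1) * hIk
  rcases Nat.eq_zero_or_pos m with rfl | hm0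
  · have hne : (0 : ℕ) ≠ k - 2 := by omega
    rw [if_pos rfl, if_neg hne, bernoulliProd_odd hk hk2 (by omega)
      (by simpa using Nat.Even.sub_odd (by omega) hk2 odd_one)]
    have hfe := Lambda_weight_sub hk0 (by exact_mod_cast hk2) (eisensteinG hk) ((k : ℂ) - 1)
    push_cast at hfe
    rw [sub_sub_cancel, htop, zpow_natCast] at hfe
    have hev : Even (k - 2) := even_sub_two hk2
    simp only [Nat.cast_zero, zero_add]
    rw [hfe, Nat.sub_zero, hev.neg_one_pow, Nat.choose_zero_right, hInv]
    have : Complex.I ^ k = Complex.I ^ (k - 1) * Complex.I := by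
      rw [← pow_succ]
      congr 1
      omega
    rw [this]
    push_cast
    linear_combination (-((k - 2).factorial : ℂ) / 2
      * (riemannZeta ((k : ℂ) - 1) / (2 * Real.pi) ^ (k - 1)) * Complex.I ^ (k - 1))
        * Complex.I_sq
  rw [if_neg hm0.ne']
  rcases eq_or_ne m (k - 2) with rfl | hmk
  · rw [if_pos rfl, bernoulliProd_odd hk hk2 (by omega)
      (by rw [show k - 1 - (k - 2) = 1 by omega]; exact odd_one)]
    have e : (((k - 2 : ℕ) : ℂ) + 1) = k - 1 := by
      rw [Nat.cast_sub (by omega)]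
      push_cast
      ring
    rw [e, htop, Nat.choose_self, Nat.sub_self, hInv, show k - 2 + 1 = k - 1 by omega]
    push_cast
    ring
  rw [if_neg hmk, Lambda_eisensteinG_add_one hk hk2 hk0 hm0 (by omega)]
  rcases m.even_or_odd with ⟨a, rfl⟩ | ⟨a, rfl⟩
  · obtain ⟨b, rfl⟩ : ∃ b, k = a + a + 2 * b + 4 := by
      obtain ⟨c, rfl⟩ := hk2
      exact ⟨c - a - 2, by omega⟩
    have hz : riemannZeta (-((a + a + 2 * b + 4 - 2 - (a + a) : ℕ) : ℂ)) = 0 := by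
      rw [show a + a + 2 * b + 4 - 2 - (a + a) = 2 * (b + 1) by omega]
      have := riemannZeta_neg_two_mul_nat_add_one b
      push_cast at this ⊢
      rwa [neg_mul] at this
    rw [hz, bernoulliProd_odd hk hk2 (by omega) ⟨a - a + b + 1, by omega⟩]
    ring
  · obtain ⟨b, rfl⟩ : ∃ b, k = 2 * a + 2 * b + 4 := by
      obtain ⟨c, rfl⟩ := hk2
      exact ⟨c - a - 2, by omega⟩
    have h := zeta_mul_zeta_eq_bernoulli a b
    rw [show 2 * a + 2 * b + 4 - 2 = 2 * a + 2 * b + 2 by omega,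
      show 2 * a + 2 * b + 2 - (2 * a + 1) = 2 * b + 1 by omega, bernoulliProd,
      show 2 * a + 2 * b + 4 - 1 - (2 * a + 1) = 2 * b + 2 by omega,
      show 2 * a + 2 * b + 4 - (2 * b + 2) = 2 * a + 2 by omega, add_zero, sub_zero, ← h]
    rw [show (((2 * a + 1 : ℕ) : ℂ) + 1) = 2 * ((a + 1 : ℕ) : ℂ) by push_cast; ring]

/-- The substitution `n = k-1-m` matches the order of the binomial expansion of the kernel; the ends
`n = 0, k` are set apart because they arise from `a₀` rather than from L-values. -/
lemma laurent_eq_sum_reflect {k : ℕ} (hk : 3 ≤ k) (c : ℕ → ℂ) (z : ℂ) :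
    laurent k c z = (∑ m ∈ Finset.range (k - 2 + 1), c (k - 1 - m) * z ^ (k - 2 - m))
      + c k * z ^ (k - 1) + c 0 / z := by
  obtain ⟨N, rfl⟩ : ∃ N, k = N + 2 := ⟨k - 2, by omega⟩
  rw [laurent, Finset.sum_range_succ, Finset.sum_range_succ', Nat.add_sub_cancel,
    ← Finset.sum_range_reflect]
  have h0 : c 0 * z ^ (((0 : ℕ) : ℤ) - 1) = c 0 / z := by
    rw [Nat.cast_zero, zero_sub, zpow_neg_one, div_eq_mul_inv]
  have hk' : z ^ (((N + 2 : ℕ) : ℤ) - 1) = z ^ (N + 2 - 1) := by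
    rw [← zpow_natCast]
    congr 1
    omega
  rw [h0, hk']
  have hsum : ∑ j ∈ Finset.range (N + 1), c (N + 1 - 1 - j + 1)
        * z ^ (((N + 1 - 1 - j + 1 : ℕ) : ℤ) - 1)
      = ∑ m ∈ Finset.range (N + 1), c (N + 2 - 1 - m) * z ^ (N - m) := by
    refine Finset.sum_congr rfl fun j hj => ?_
    have hj := Finset.mem_range.1 hj
    rw [show N + 1 - 1 - j + 1 = N + 2 - 1 - j by omega, ← zpow_natCast]
    congr 2
    omega
  rw [hsum]
  ring

/-- The period function of the Eisenstein series. -/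
theorem period_eisensteinG {k : ℕ} (hk : 3 ≤ k) (hk2 : Even k) {t₀ : ℝ} (ht₀ : 0 < t₀) {z : ℂ}
    (hz : z ≠ 0) :
    period k (eisensteinG hk) t₀ z = -((k - 2).factorial : ℂ) / 2 *
      (laurent k (bernoulliProd k) z + zetaCoeff k * (z ^ (k - 2) - 1)) := by
  have hk0 : (0 : ℤ) < k := by omega
  rw [period_eq_sum_Lambda hk0 _ hk hk2 hz ht₀, laurent_eq_sum_reflect hk,
    valueAtInfty_eisensteinG hk hk2]
  have hsum : ∑ m ∈ Finset.range (k - 2 + 1),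
        (((k - 2).choose m : ℂ) * (-z) ^ (k - 2 - m) * Complex.I ^ (m + 1))
          * ModularForm.Λ hk0 (eisensteinG hk) ((m : ℂ) + 1)
      = -((k - 2).factorial : ℂ) / 2
        * ((∑ m ∈ Finset.range (k - 2 + 1), bernoulliProd k (k - 1 - m) * z ^ (k - 2 - m))
          + zetaCoeff k * (z ^ (k - 2) - 1)) := by
    have h1 : ∑ m ∈ Finset.range (k - 2 + 1),
        (if m = 0 then zetaCoeff k else 0) * z ^ (k - 2 - m) = zetaCoeff k * z ^ (k - 2) := by
      simp
    have h2 : ∑ m ∈ Finset.range (k - 2 + 1),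
        (if m = k - 2 then zetaCoeff k else 0) * z ^ (k - 2 - m) = zetaCoeff k := by
      simp
    have h3 : zetaCoeff k * (z ^ (k - 2) - 1) = zetaCoeff k * z ^ (k - 2) - zetaCoeff k := by ring
    rw [h3, ← h1]
    conv_rhs => enter [2, 2, 2]; rw [← h2]
    rw [← Finset.sum_sub_distrib, ← Finset.sum_add_distrib, Finset.mul_sum]
    refine Finset.sum_congr rfl fun m hm => ?_
    have h := choose_mul_Lambda_eisensteinG hk hk2 hk0
      (Nat.lt_succ_iff.1 (Finset.mem_range.1 hm))
    rw [neg_pow z]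
    linear_combination z ^ (k - 2 - m) * h
  -- Since `B_0 = 1`, the two end coefficients both equal `a₀/(k-1)`, the factor of `z^(k-1) + 1/z`.
  have ha : ∀ n, n = 0 ∨ n = k → -((k - 2).factorial : ℂ) / 2 * bernoulliProd k n
      = -(bernoulli k : ℂ) / (2 * k) / (k - 1) := by
    obtain ⟨N, rfl⟩ : ∃ N, k = N + 2 := ⟨k - 2, by omega⟩
    have hf : ((N + 2).factorial : ℂ) = (N + 2) * ((N + 1) * N.factorial) := by
      rw [Nat.factorial_succ, Nat.factorial_succ]
      push_cast
      ring
    have h1 : (N.factorial : ℂ) ≠ 0 := Nat.cast_ne_zero.2 (Nat.factorial_ne_zero _)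
    have h2 : (N : ℂ) + 1 ≠ 0 := Nat.cast_add_one_ne_zero N
    have h3 : (N : ℂ) + 2 ≠ 0 := by exact_mod_cast Nat.succ_ne_zero (N + 1)
    have h4 : (((N + 2 : ℕ) : ℂ) - 1) = N + 1 := by push_cast; ring
    rintro n (rfl | rfl)
    · rw [bernoulliProd, Nat.sub_zero, hf, Nat.add_sub_cancel, h4]
      push_cast
      simp
      field_simp
    · rw [bernoulliProd, Nat.sub_self, hf, Nat.add_sub_cancel, h4]
      push_cast
      simp
      field_simp
  rw [hsum]
  have ha0 := ha 0 (Or.inl rfl)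
  have hak := ha k (Or.inr rfl)
  linear_combination -z ^ (k - 1) * hak - z⁻¹ * ha0

/-! ### Odd part and three-term relations of the period function -/

lemma laurent_const_mul (k : ℕ) (a : ℂ) (c : ℕ → ℂ) (z : ℂ) :
    laurent k (fun n => a * c n) z = a * laurent k c z := by
  rw [laurent, laurent, Finset.mul_sum]
  exact Finset.sum_congr rfl fun n _ => by ring

lemma laurent_neg {k : ℕ} {c : ℕ → ℂ} (hodd : ∀ n, n ≤ k → Odd n → c n = 0) (z : ℂ) :
    laurent k c (-z) = -laurent k c z := by
  rw [laurent, laurent, ← Finset.sum_neg_distrib]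
  refine Finset.sum_congr rfl fun n hn => ?_
  rcases n.even_or_odd with h | h
  · have : Odd ((n : ℤ) - 1) := Even.sub_odd (by exact_mod_cast h) odd_one
    rw [this.neg_zpow, mul_neg]
  · rw [hodd n (Nat.lt_succ_iff.1 (Finset.mem_range.1 hn)) h]
    simp

/-- The odd part of the period function of the Eisenstein series. -/
theorem oddPart_period_eisensteinG {k : ℕ} (hk : 3 ≤ k) (hk2 : Even k) {t₀ : ℝ} (ht₀ : 0 < t₀)
    {z : ℂ} (hz : z ≠ 0) :
    oddPart (period k (eisensteinG hk) t₀) z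
      = -((k - 2).factorial : ℂ) / 2 * laurent k (bernoulliProd k) z := by
  have hev : Even (k - 2) := even_sub_two hk2
  rw [oddPart, period_eisensteinG hk hk2 ht₀ hz,
    period_eisensteinG hk hk2 ht₀ (neg_ne_zero.2 hz),
    laurent_neg (fun n hn h => bernoulliProd_odd hk hk2 hn h), hev.neg_pow]
  ring

theorem threeTerm_oddPart_period {k : ℕ} (hk : 3 ≤ k) (hk2 : Even k) {t₀ : ℝ} (ht₀ : 0 < t₀) :
    ThreeTerm k (oddPart (period k (eisensteinG hk) t₀)) := by
  intro z hz hz1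
  rw [oddPart_period_eisensteinG hk hk2 ht₀ hz,
    oddPart_period_eisensteinG hk hk2 ht₀ (div_ne_zero hz (sub_ne_zero.2 hz1)),
    oddPart_period_eisensteinG hk hk2 ht₀ (div_ne_zero one_ne_zero (sub_ne_zero.2 hz1.symm))]
  linear_combination (-((k - 2).factorial : ℂ) / 2)
    * threeTerm_laurent_bernoulliProd hk hk2 z hz hz1

/-- Palindromy is invariance under inversion of the argument. It reconciles the argument `(z-1)/z`
in the relation for the whole period with `z/(z-1)` in `ThreeTerm`. -/
lemma pow_mul_laurent_inv {k : ℕ} (hk : 3 ≤ k) {c : ℕ → ℂ} (hc : ∀ n, n ≤ k → c (k - n) = c n)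
    {x y : ℂ} (hx : x ≠ 0) (hy : y ≠ 0) :
    y ^ (k - 2) * laurent k c (x / y) = x ^ (k - 2) * laurent k c (y / x) := by
  have hk1 : ((k : ℤ) - 1) = ((k - 2 : ℕ) : ℤ) + 1 := by omega
  rw [laurent_eq_homog k c hx hy, laurent_eq_homog k c hy hx, homog_comm hc y x, hk1,
    zpow_add_one₀ hx, zpow_add_one₀ hy, zpow_natCast, zpow_natCast]
  have := pow_ne_zero (k - 2) hx
  have := pow_ne_zero (k - 2) hy
  field_simp

/-- The three-term relation for the whole period function of the Eisenstein series. -/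
theorem period_eisensteinG_three_term {k : ℕ} (hk : 3 ≤ k) (hk2 : Even k) {t₀ : ℝ} (ht₀ : 0 < t₀)
    {z : ℂ} (hz : z ≠ 0) (hz1 : z ≠ 1) :
    period k (eisensteinG hk) t₀ z + z ^ (k - 2) * period k (eisensteinG hk) t₀ ((z - 1) / z)
      + (1 - z) ^ (k - 2) * period k (eisensteinG hk) t₀ (1 / (1 - z)) = 0 := by
  have h1 : z - 1 ≠ 0 := sub_ne_zero.2 hz1
  have h2 : 1 - z ≠ 0 := sub_ne_zero.2 hz1.symm
  have hev : Even (k - 2) := even_sub_two hk2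
  rw [period_eisensteinG hk hk2 ht₀ hz, period_eisensteinG hk hk2 ht₀ (div_ne_zero h1 hz),
    period_eisensteinG hk hk2 ht₀ (div_ne_zero one_ne_zero h2)]
  have h3 := threeTerm_laurent_bernoulliProd hk hk2 z hz hz1
  have h4 := pow_mul_laurent_inv hk (c := bernoulliProd k) (fun n hn => bernoulliProd_symm hn)
    h1 hz
  -- For `z^(k-2) - 1` the three terms are `z^(k-2) - 1`, `(z-1)^(k-2) - z^(k-2)` and `1 -
  -- (1-z)^(k-2)`, which cancel since `k - 2` is even.
  have h5 : z ^ (k - 2) * ((z - 1) / z) ^ (k - 2) = (z - 1) ^ (k - 2) := by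
    rw [← mul_pow, mul_div_cancel₀ _ hz]
  have h6 : (1 - z) ^ (k - 2) * (1 / (1 - z)) ^ (k - 2) = 1 := by
    rw [← mul_pow, mul_one_div_cancel h2, one_pow]
  have h7 : (1 - z) ^ (k - 2) = (z - 1) ^ (k - 2) := by
    rw [← neg_sub, hev.neg_pow]
  linear_combination (-((k - 2).factorial : ℂ) / 2)
    * (h3 + h4 + zetaCoeff k * (h5 + h6 - h7))

end SunPan

end

theorem corollary3p2 :
    -- the period function of the Eisenstein series, and its three-term relations
    (∀ (k : ℕ) (hk : 3 ≤ k), Even k → ∀ t₀ : ℝ, 0 < t₀ →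
      -- the regularized period integral converges
      (∀ z : ℂ,
        MeasureTheory.IntegrableOn
          (SunPan.upperIntegrand k (SunPan.eisensteinG hk) z) (Set.Ioi t₀) ∧
        MeasureTheory.IntegrableOn
          (SunPan.lowerIntegrand k (SunPan.eisensteinG hk) z) (Set.Ioc 0 t₀)) ∧
      -- all its coefficients
      (∀ z : ℂ, z ≠ 0 →
        SunPan.period k (SunPan.eisensteinG hk) t₀ z =
          -((k - 2).factorial : ℂ) / 2 *
            (SunPan.laurent k (fun n => (bernoulli n : ℂ) / (n.factorial : ℂ) *
                ((bernoulli (k - n) : ℂ) / ((k - n).factorial : ℂ))) z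
              + riemannZeta ((k : ℂ) - 1) / (2 * Real.pi * Complex.I) ^ (k - 1)
                * (z ^ (k - 2) - 1))) ∧
      -- the odd part has Bernoulli coefficients
      (∀ z : ℂ, z ≠ 0 →
        SunPan.oddPart (SunPan.period k (SunPan.eisensteinG hk) t₀) z =
          SunPan.laurent k (fun n => -((k - 2).factorial : ℂ) / 2 *
            ((bernoulli n : ℂ) / (n.factorial : ℂ) *
              ((bernoulli (k - n) : ℂ) / ((k - n).factorial : ℂ)))) z) ∧
      -- the three-term relation for the whole period function
      (∀ z : ℂ, z ≠ 0 → z ≠ 1 →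
        SunPan.period k (SunPan.eisensteinG hk) t₀ z
          + z ^ (k - 2) * SunPan.period k (SunPan.eisensteinG hk) t₀ ((z - 1) / z)
          + (1 - z) ^ (k - 2) * SunPan.period k (SunPan.eisensteinG hk) t₀ (1 / (1 - z)) = 0) ∧
      -- the three-term relation for the odd part
      SunPan.ThreeTerm k (SunPan.oddPart (SunPan.period k (SunPan.eisensteinG hk) t₀))) ∧
    -- the three-term relation yields the cyclic identity for the coefficients
    (∀ (k : ℕ), 2 ≤ k → Even k → ∀ c : ℕ → ℂ,
      (∀ n, Odd n → c n = 0) → (∀ n, n ≤ k → c (k - n) = c n) →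
      SunPan.ThreeTerm k (SunPan.laurent k c) →
      ∀ r s t : ℂ, r + s + t = k →
        r * SunPan.weightedBracket s t k (fun j => (j.factorial : ℂ) * ((k - j).factorial : ℂ) * c j)
        + s * SunPan.weightedBracket t r k
            (fun j => (j.factorial : ℂ) * ((k - j).factorial : ℂ) * c j)
        + t * SunPan.weightedBracket r s k
            (fun j => (j.factorial : ℂ) * ((k - j).factorial : ℂ) * c j) = 0) ∧
    -- the cyclic identity for Bernoulli polynomials
    (∀ (n : ℕ) (r s t x y z : ℂ), r + s + t = n → x + y + z = 1 →
      r * SunPan.bracket s t x y n + s * SunPan.bracket t r y z n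
        + t * SunPan.bracket r s z x n = 0) := by
  refine ⟨fun k hk hk2 t₀ ht₀ => ⟨fun z => ⟨?_, ?_⟩, fun z hz => ?_, fun z hz => ?_,
    fun z hz hz1 => ?_, ?_⟩, fun k hk hk2 c hodd hc h r s t hrst => ?_,
    fun n r s t x y z hrst hxyz => ?_⟩
  · exact SunPan.integrableOn_upperIntegrand (by omega) _ z ht₀
  · exact SunPan.integrableOn_lowerIntegrand (by omega) _ hk2 z t₀
  · exact SunPan.period_eisensteinG hk hk2 ht₀ hz
  · rw [SunPan.oddPart_period_eisensteinG hk hk2 ht₀ hz, SunPan.laurent_const_mul]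
    rfl
  · exact SunPan.period_eisensteinG_three_term hk hk2 ht₀ hz hz1
  · exact SunPan.threeTerm_oddPart_period hk hk2 ht₀
  · exact SunPan.cyclic_of_threeTerm hk hk2 hodd hc h hrst
  · exact SunPan.bracket_cyclic hrst hxyz
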